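/- **Theorem C.** Let either $\mathbb K=\mathbb R$ and $r\in\{1,2,\dots\}\cup\{\infty,\omega\}$, or $\mathbb K=\mathbb C$ and $r=\omega$; here $C^r_{\mathbb R}$ for $r\le\infty$ means continuously differentiable in the Michal–Bastiani (Keller $C^r_c$) sense (iterated directional derivatives exist and are jointly continuous), $C^\omega_{\mathbb C}$ means complex analytic (continuous and locally a pointwise convergent series of continuous homogeneous polynomials), and $C^\omega_{\mathbb R}$ means real analytic (extending to a complex analytic map between open sets of the complexifications). Let $M$ and $N$ be (Hausdorff) $C^r_{\mathbb K}$-manifolds modelled on Hausdorff locally convex topological $\mathbb K$-vector spaces $E$ and $F$, respectively. Let $f\colon M\to N$ be a $C^r_{\mathbb K}$-submersion, i.e. a $C^r_{\mathbb K}$-map such that for each $x\in M$ there are charts $\phi\colon U_\phi\to V_\phi\subseteq E$ of $M$ with $x\in U_\phi$ and $\psi\colon U_\psi\to V_\psi\subseteq F$ of $N$ with $f(U_\phi)\subseteq U_\psi$ and $\psi\circ f\circ\phi^{-1}=\pi|_{V_\phi}$ for a continuous linear map $\pi\colon E\to F$ that has a continuous linear right inverse. Let $S\subseteq N$ be a $C^r_{\mathbb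 K}$-submanifold modelled on a closed vector subspace $Y\subseteq F$, i.e. for each $s\in S$ there is a chart $\psi\colon U_\psi\to V_\psi$ of $N$ with $s\in U_\psi$ and $\psi(U_\psi\cap S)=V_\psi\cap Y$; the restrictions $U_\psi\cap S\to V_\psi\cap Y$ of such charts make $S$ a $C^r_{\mathbb K}$-manifold modelled on $Y$. Then: 1. $f^{-1}(S)$ is a (not necessarily pure) $C^r_{\mathbb K}$-submanifold of $M$: its connected components $C$ are open in $f^{-1}(S)$, and each $C$ is a $C^r_{\mathbb K}$-submanifold of $M$ modelled on some closed vector subspace $Z_C\subseteq E$. 2. $f$ restricts to a $C^r_{\mathbb K}$-submersion $f^{-1}(S)\to S$, i.e. $f|_C\colon C\to S$ is a $C^r_{\mathbb K}$-submersion for each connected component $C$ of $f^{-1}(S)$. 3. $T_x(f^{-1}(S))=(T_xf)^{-1}(T_{f(x)}S)$ for each $x\in f^{-1}(S)$. 4. If $S$ has finite codimension $k$ in $N$ (that is, $\dim_{\mathbb K}(F/Y)=k$), then $f^{-1}(S)$ has codimension $k$ in $M$ (that is, $\dim_{\mathbb K}(E/Z_C)=k$ for each $C$). 5. If $S$ is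 a split submanifold of $N$ (that is, $Y$ is complemented in $F$ as a topological vector space), then $f^{-1}(S)$ is a split submanifold of $M$ (that is, each $Z_C$ is complemented in $E$). Assertions 2–5 hold for every choice of closed vector subspaces $Z_C$ on which the components $C$ can be modelled. -/

import Mathlib

open Filter Topology Set

/-! ### Differential calculus in locally convex spaces -/

section Calculus

universe u v

/-- `w` is the directional derivative of `f` at `x` in the direction `v`, over the field `𝕜`:
`w = lim (f (x + t v) - f x) / t` as `t → 0`, `0 ≠ t ∈ 𝕜`. -/
def HasDirDeriv (𝕜 : Type) [NontriviallyNormedField 𝕜] {E : Type u} {F : Type v}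
    [AddCommGroup E] [Module 𝕜 E] [AddCommGroup F] [Module 𝕜 F] [TopologicalSpace F]
    (f : E → F) (x v : E) (w : F) : Prop :=
  Tendsto (fun t : 𝕜 => t⁻¹ • (f (x + t • v) - f x)) (𝓝[≠] 0) (𝓝 w)

/-- `f` is of class `C^k` (`k` finite, real scalars) on the open set `U`: for `k = 0`, `f` is
continuous on `U`; and `f` is `C^{k+1}` if it is continuous, all directional derivatives
`df (x, v)` with `x ∈ U`, `v ∈ E` exist, and `df` is `C^k` on the open set `U × E ⊆ E × E`. -/
def CkOn {F : Type v} [AddCommGroup F] [Module ℝ F] [TopologicalSpace F] :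
    (k : ℕ) → {E : Type u} → [AddCommGroup E] → [Module ℝ E] → [TopologicalSpace E] →
      (E → F) → Set E → Prop
  | 0, _, _, _, _, f, U => ContinuousOn f U
  | k + 1, E, _, _, _, f, U => ContinuousOn f U ∧ ∃ df : E × E → F,
      (∀ x ∈ U, ∀ v : E, HasDirDeriv ℝ f x v (df (x, v))) ∧ CkOn k df (U ×ˢ (univ : Set E))

/-- `f` is complex analytic on the open set `U`: it is continuous and, near each `x ∈ U`, it is the
pointwise limit `f (x + y) = ∑ₙ βₙ y` with continuous homogeneous polynomials `βₙ` of degree `n`,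
i.e. `βₙ y = p n (y, …, y)` for a continuous `n`-linear map `p n`. -/
def ComplexAnalyticOn {E : Type u} {F : Type v}
    [AddCommGroup E] [Module ℂ E] [TopologicalSpace E]
    [AddCommGroup F] [Module ℂ F] [TopologicalSpace F] (f : E → F) (U : Set E) : Prop :=
  ContinuousOn f U ∧ ∀ x ∈ U,
    ∃ p : (n : ℕ) → ContinuousMultilinearMap ℂ (fun _ : Fin n => E) F,
    ∃ V ∈ 𝓝 (0 : E), ∀ y ∈ V, x + y ∈ U ∧
      Tendsto (fun m : ℕ => ∑ n ∈ Finset.range m, p n (fun _ => y)) atTop (𝓝 (f (x + y)))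

/-- The complexification `E_ℂ = E ⊕ iE` of a real topological vector space, with the product
topology; the pair `(x, y)` stands for `x + iy`. -/
def Complexification (E : Type u) : Type u := E × E

namespace Complexification

variable {E : Type u}

instance [AddCommGroup E] : AddCommGroup (Complexification E) :=
  inferInstanceAs (AddCommGroup (E × E))

instance [TopologicalSpace E] : TopologicalSpace (Complexification E) :=
  inferInstanceAs (TopologicalSpace (E × E))

theorem ext' {a b : Complexification E} (h₁ : a.1 = b.1) (h₂ : a.2 = b.2) : a = b :=
  Prod.ext h₁ h₂

section

variable [AddCommGroup E]

theorem add_fst (a b : Complexification E) : (a + b).1 = a.1 + b.1 := rfl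
theorem add_snd (a b : Complexification E) : (a + b).2 = a.2 + b.2 := rfl
theorem zero_fst : (0 : Complexification E).1 = 0 := rfl
theorem zero_snd : (0 : Complexification E).2 = 0 := rfl

/-- The embedding `E → E_ℂ`, `x ↦ x + i0`. -/
def ofReal (x : E) : Complexification E := (x, 0)

end

variable [AddCommGroup E] [Module ℝ E]

instance : SMul ℂ (Complexification E) :=
  ⟨fun z w => (z.re • w.1 - z.im • w.2, z.re • w.2 + z.im • w.1)⟩

theorem smul_fst (z : ℂ) (w : Complexification E) : (z • w).1 = z.re • w.1 - z.im • w.2 := rfl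
theorem smul_snd (z : ℂ) (w : Complexification E) : (z • w).2 = z.re • w.2 + z.im • w.1 := rfl

instance : Module ℂ (Complexification E) where
  one_smul w := by apply ext' <;> simp [smul_fst, smul_snd]
  mul_smul z z' w := by
    apply ext' <;> simp only [smul_fst, smul_snd, Complex.mul_re, Complex.mul_im] <;> module
  smul_zero z := by apply ext' <;> simp [smul_fst, smul_snd, zero_fst, zero_snd]
  smul_add z a b := by
    apply ext' <;> simp only [smul_fst, smul_snd, add_fst, add_snd] <;> module
  add_smul z z' w := by
    apply ext' <;>
      simp only [smul_fst, smul_snd, add_fst, add_snd, Complex.add_re, Complex.add_im] <;> module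
  zero_smul w := by apply ext' <;> simp [smul_fst, smul_snd, zero_fst, zero_snd]

end Complexification

/-- `f` is real analytic on the open set `U`: it extends to a complex analytic map into `F_ℂ` on
some open neighbourhood of `U` in `E_ℂ`. -/
def RealAnalyticOn {E : Type u} {F : Type v}
    [AddCommGroup E] [Module ℝ E] [TopologicalSpace E]
    [AddCommGroup F] [Module ℝ F] [TopologicalSpace F] (f : E → F) (U : Set E) : Prop :=
  ∃ (W : Set (Complexification E)) (g : Complexification E → Complexification F),
    IsOpen W ∧ (∀ x ∈ U, Complexification.ofReal x ∈ W) ∧ ComplexAnalyticOn g W ∧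
      ∀ x ∈ U, g (Complexification.ofReal x) = Complexification.ofReal (f x)

end Calculus

/-- The admissible pairs `(𝕂, r)`: `𝕂 = ℝ` and `r ∈ {1, 2, …} ∪ {∞}`; `𝕂 = ℝ` and `r = ω`;
`𝕂 = ℂ` and `r = ω`. -/
inductive CrClass : Type
  | real (r : ℕ∞) (hr : 1 ≤ r) : CrClass
  | realAnalytic : CrClass
  | complexAnalytic : CrClass

namespace CrClass

universe u v w z

/-- The ground field `𝕂` of the class `(𝕂, r)`. -/
abbrev field : CrClass → Type
  | real _ _ => ℝ
  | realAnalytic => ℝ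
  | complexAnalytic => ℂ

noncomputable instance instField : (c : CrClass) → NontriviallyNormedField c.field
  | real _ _ => inferInstanceAs (NontriviallyNormedField ℝ)
  | realAnalytic => inferInstanceAs (NontriviallyNormedField ℝ)
  | complexAnalytic => inferInstanceAs (NontriviallyNormedField ℂ)

/-- `f` is a `C^r_𝕂`-map on the open set `U`. -/
def On : (c : CrClass) → {E : Type u} → {F : Type v} →
    [AddCommGroup E] → [Module c.field E] → [TopologicalSpace E] →
    [AddCommGroup F] → [Module c.field F] → [TopologicalSpace F] → (E → F) → Set E → Prop
  | real r _, E, F, _, i, _, _, j, _, f, U =>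
      letI : Module ℝ E := i
      letI : Module ℝ F := j
      ∀ k : ℕ, (k : ℕ∞) ≤ r → CkOn k f U
  | realAnalytic, E, F, _, i, _, _, j, _, f, U =>
      letI : Module ℝ E := i
      letI : Module ℝ F := j
      RealAnalyticOn f U
  | complexAnalytic, E, F, _, i, _, _, j, _, f, U =>
      letI : Module ℂ E := i
      letI : Module ℂ F := j
      ComplexAnalyticOn f U

/-! ### Manifolds, maps, submersions -/

section Manifolds

variable (c : CrClass)
  {E : Type u} [AddCommGroup E] [Module c.field E] [TopologicalSpace E]
  {F : Type v} [AddCommGroup F] [Module c.field F] [TopologicalSpace F]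
  {M : Type w} [TopologicalSpace M] [ChartedSpace E M]
  {N : Type z} [TopologicalSpace N] [ChartedSpace F N]

/-- `φ` belongs to the maximal `C^r_𝕂`-atlas of `M`, i.e. the changes of coordinates between `φ` and
the charts of the given atlas are `C^r_𝕂` in both directions. -/
def IsChart (φ : OpenPartialHomeomorph M E) : Prop :=
  ∀ e ∈ atlas E M,
    c.On (fun y => e (φ.symm y)) (φ.symm.trans e).source ∧
    c.On (fun y => φ (e.symm y)) (e.symm.trans φ).source

variable (E F)

/-- The atlas of `M` is a `C^r_𝕂`-atlas, i.e. `M` is a `C^r_𝕂`-manifold modelled on `E`. -/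
class IsCrManifold (M : Type w) [TopologicalSpace M] [ChartedSpace E M] : Prop where
  isChart_of_mem_atlas : ∀ e ∈ atlas E M, c.IsChart e

/-- `f` is a `C^r_𝕂`-map between manifolds: it is continuous, and `C^r_𝕂` in charts. -/
def IsMap (f : M → N) : Prop :=
  Continuous f ∧ ∀ φ ∈ atlas E M, ∀ ψ ∈ atlas F N,
    c.On (fun y => ψ (f (φ.symm y))) (φ.target ∩ φ.symm ⁻¹' (f ⁻¹' ψ.source))

/-- `f` is a `C^r_𝕂`-submersion: it is a `C^r_𝕂`-map and around each point there are charts in which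
`f` is the restriction of a continuous linear map with a continuous linear right inverse. -/
def IsSubmersion (f : M → N) : Prop :=
  c.IsMap E F f ∧ ∀ x : M, ∃ (φ : OpenPartialHomeomorph M E) (ψ : OpenPartialHomeomorph N F)
    (π : E →L[c.field] F) (σ : F →L[c.field] E),
    c.IsChart φ ∧ c.IsChart ψ ∧ x ∈ φ.source ∧ f x ∈ ψ.source ∧
    MapsTo f φ.source ψ.source ∧ (∀ y : F, π (σ y) = y) ∧
    ∀ y ∈ φ.target, ψ (f (φ.symm y)) = π y

/-- The tangent space `T_xM`, identified with the modelling space `E` by means of the preferred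
chart `chartAt E x`. -/
abbrev TangentSp {M : Type w} (_x : M) : Type u := E

/-- The tangent map `T_xf : T_xM → T_{f(x)}N`: the directional derivative, at the point
corresponding to `x`, of `f` expressed in the preferred charts around `x` and `f x`.
The limit exists if `f` is a `C^r_𝕂`-map. -/
noncomputable def tangentMap (f : M → N) (x : M) (v : TangentSp E x) : TangentSp F (f x) :=
  let g : E → F := fun y => chartAt F (f x) (f ((chartAt E x).symm y))
  let p : E := chartAt E x x
  limUnder (𝓝[≠] (0 : c.field)) (fun t : c.field => t⁻¹ • (g (p + t • v) - g p))

end Manifolds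

/-! ### Submanifolds -/

section Submanifolds

variable (c : CrClass)
  {E : Type u} [AddCommGroup E] [Module c.field E] [TopologicalSpace E]
  {M : Type w} [TopologicalSpace M] [ChartedSpace E M]

/-- `φ` is a chart `U → V` of `M` with `φ (U ∩ S) = V ∩ Y`. -/
structure IsSubmanifoldChart (Y : Submodule c.field E) (S : Set M)
    (φ : OpenPartialHomeomorph M E) : Prop where
  isChart : c.IsChart φ
  image_eq : φ '' (φ.source ∩ S) = φ.target ∩ (Y : Set E)

/-- `S` is a (pure) `C^r_𝕂`-submanifold of `M` modelled on the closed vector subspace `Y ⊆ E`. -/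
structure IsSubmanifold (Y : Submodule c.field E) (S : Set M) : Prop where
  isClosed : IsClosed (Y : Set E)
  exists_chart : ∀ x ∈ S, ∃ φ : OpenPartialHomeomorph M E,
    c.IsSubmanifoldChart Y S φ ∧ x ∈ φ.source

variable {c}

/-- `e : U ∩ S → V ∩ Y` is the restriction of `φ : U → V`. -/
structure IsRestriction {Y : Submodule c.field E} {S : Set M}
    (φ : OpenPartialHomeomorph M E) (e : OpenPartialHomeomorph S Y) : Prop where
  source_eq : e.source = Subtype.val ⁻¹' φ.source
  target_eq : e.target = Subtype.val ⁻¹' φ.target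
  apply_eq : ∀ s ∈ e.source, (e s : E) = φ s

theorem IsSubmanifoldChart.exists_isRestriction {Y : Submodule c.field E} {S : Set M}
    {φ : OpenPartialHomeomorph M E} (h : c.IsSubmanifoldChart Y S φ) (s₀ : S) :
    ∃ e : OpenPartialHomeomorph S Y, IsRestriction φ e := by
  classical
  have h1 : ∀ s : S, (s : M) ∈ φ.source → φ s ∈ Y := fun s hs =>
    (h.image_eq.subset ⟨s, ⟨hs, s.2⟩, rfl⟩).2
  have h2 : ∀ y : Y, (y : E) ∈ φ.target → φ.symm y ∈ S := by
    intro y hy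
    obtain ⟨x, ⟨hx, hxS⟩, hxy⟩ := h.image_eq.superset ⟨hy, y.2⟩
    rw [← hxy, φ.left_inv hx]
    exact hxS
  refine ⟨{ toFun := fun s => if hs : φ s ∈ Y then ⟨φ s, hs⟩ else 0
            invFun := fun y => if hy : φ.symm y ∈ S then ⟨φ.symm y, hy⟩ else s₀
            source := Subtype.val ⁻¹' φ.source
            target := Subtype.val ⁻¹' φ.target
            map_source' := ?_
            map_target' := ?_
            left_inv' := ?_
            right_inv' := ?_
            open_source := φ.open_source.preimage continuous_subtype_val
            open_target := φ.open_target.preimage continuous_subtype_val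
            continuousOn_toFun := ?_
            continuousOn_invFun := ?_ }, ⟨rfl, rfl, ?_⟩⟩
  · intro s hs
    simpa [h1 s hs] using φ.map_source hs
  · intro y hy
    simpa [h2 y hy] using φ.map_target hy
  · intro s hs
    have hs' : (s : M) ∈ φ.source := hs
    apply Subtype.ext
    simp [h1 s hs, φ.left_inv hs']
  · intro y hy
    have hy' : (y : E) ∈ φ.target := hy
    apply Subtype.ext
    simp [h2 y hy, φ.right_inv hy']
  · rw [Topology.IsInducing.subtypeVal.continuousOn_iff]
    refine ContinuousOn.congr (f := fun s : S => φ s)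
      (φ.continuousOn.comp continuous_subtype_val.continuousOn (fun s hs => hs)) ?_
    intro s hs
    simp [h1 s hs]
  · rw [Topology.IsInducing.subtypeVal.continuousOn_iff]
    refine ContinuousOn.congr (f := fun y : Y => φ.symm y)
      (φ.continuousOn_symm.comp continuous_subtype_val.continuousOn (fun y hy => hy)) ?_
    intro y hy
    simp [h2 y hy]
  · intro s hs
    have hs' : (s : M) ∈ φ.source := hs
    simp [h1 s hs']

theorem IsSubmanifold.exists_restriction {Y : Submodule c.field E} {S : Set M}
    (h : c.IsSubmanifold Y S) (s : S) :
    ∃ e : OpenPartialHomeomorph S Y, s ∈ e.source ∧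
      ∃ φ : OpenPartialHomeomorph M E, c.IsSubmanifoldChart Y S φ ∧ IsRestriction φ e := by
  obtain ⟨φ, hφ, hs⟩ := h.exists_chart s s.2
  obtain ⟨e, he⟩ := hφ.exists_isRestriction s
  exact ⟨e, by rw [he.source_eq]; exact hs, φ, hφ, he⟩

/-- The manifold structure of a submanifold `S`: its atlas consists of the restrictions
`U ∩ S → V ∩ Y` of all charts `φ : U → V` of `M` with `φ (U ∩ S) = V ∩ Y`. -/
@[reducible]
noncomputable def IsSubmanifold.chartedSpace {Y : Submodule c.field E} {S : Set M}
    (h : c.IsSubmanifold Y S) : ChartedSpace Y S where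
  atlas := {e | ∃ φ : OpenPartialHomeomorph M E, c.IsSubmanifoldChart Y S φ ∧ IsRestriction φ e}
  chartAt s := (h.exists_restriction s).choose
  mem_chart_source s := (h.exists_restriction s).choose_spec.1
  chart_mem_atlas s := (h.exists_restriction s).choose_spec.2

/-- The tangent space `T_sS` of a submanifold `S`, as a subset of `T_sM`: the range of the tangent
map of the inclusion `S → M`. -/
noncomputable def IsSubmanifold.tangent {Y : Submodule c.field E} {S : Set M}
    (h : c.IsSubmanifold Y S) (s : S) : Set (TangentSp E (s : M)) :=
  letI := h.chartedSpace
  Set.range (c.tangentMap Y E (Subtype.val : S → M) s)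

variable (c E)

/-- `P` is a not necessarily pure `C^r_𝕂`-submanifold of `M`: the connected components of `P` are
open in `P`, and each of them is a `C^r_𝕂`-submanifold of `M` modelled on some closed vector
subspace of `E` (which may depend on the component). -/
def IsNotNecessarilyPureSubmanifold (P : Set M) : Prop :=
  ∀ x ∈ P, IsOpen (Subtype.val ⁻¹' connectedComponentIn P x : Set P) ∧
    ∃ Z : Submodule c.field E, c.IsSubmanifold Z (connectedComponentIn P x)

variable {E}

/-- The vector subspace `Y ⊆ E` has finite codimension `k`. -/
def HasCodim (Y : Submodule c.field E) (k : ℕ) : Prop :=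
  Module.Finite c.field (E ⧸ Y) ∧ Module.finrank c.field (E ⧸ Y) = k

end Submanifolds

end CrClass

-- Around a point of `f ⁻¹' S`, let `f` be read as a continuous linear map `π` with right inverse
-- `σ` in charts `φ₀` and `ψ₀`, and let `θ` be a submanifold chart of `S`. The given `ψ₀` need not
-- be adapted to `S`, so `f` has to be read in `θ` without losing linearity. With `T = θ ∘ ψ₀⁻¹`,
-- the map `Φ y = y + σ (T (π y) - π y)` satisfies `π ∘ Φ = T ∘ π`, and the same formula with `T⁻¹`
-- inverts it. In the chart `Φ ∘ φ₀` the map `θ ∘ f` is again `π`, and `f ⁻¹' S` becomes the closed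
-- subspace `π ⁻¹ (Y)` (`IsSubmersion.exists_normalForm`).
--
-- After shrinking, each such chart meets `f ⁻¹' S` in a connected set, which therefore lies in one
-- component; so components are open. The subspaces `π ⁻¹ (Y)` found at different points differ, but
-- where two submanifold charts overlap, the derivative of their transition is an automorphism of
-- `E` carrying one subspace onto the other, because the subspaces are closed. Along a connected
-- component all of them are thus related by automorphisms, and one model `Z` serves
-- (`exists_isSubmanifold_of_isPreconnected`). The same comparison applies to any admissible `Z`: it
-- is the preimage of `Y` under a split surjection (`IsSubmersion.exists_split_model`). Codimension
-- and complementedness are then linear algebra, and the tangent space formula is the chain rule.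
--
-- All this rests on a calculus for the three classes of maps: chain rule, locality, Hadamard
-- derivatives, and the fact that a map is `C^r` once its composite with a linear closed embedding
-- is; the last makes restrictions of charts to `S` into charts with values in `Y`. The model spaces
-- need not be complete, so limits are tested by continuous linear maps to Banach spaces. The class
-- `C^k` is treated over `ℝ` and `ℂ` together as `CkGen`; complex analytic means `CkGen` of every
-- order over `ℂ` (`ComplexAnalyticOn.ckGen`, `complexAnalyticOn_of_ckGen`). Real analytic maps are
-- handled through complex extensions, with an identity theorem (`eq_of_eq_on_real`) for gluing them
-- and controlling their values.

universe u v w z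

set_option linter.unusedSectionVars false

/-! ### Seminorms, Banach spaces and directional derivatives -/

namespace LocallyConvexCalculus

section Factorization

variable {𝕜 : Type} [RCLike 𝕜] {F : Type v} [AddCommGroup F] [Module 𝕜 F]

/-- The vector space underlying a seminorm, to be endowed with the topology of that seminorm. -/
def SeminormedCopy (_p : Seminorm 𝕜 F) : Type v := F

instance (p : Seminorm 𝕜 F) : AddCommGroup (SeminormedCopy p) := inferInstanceAs (AddCommGroup F)

instance (p : Seminorm 𝕜 F) : Module 𝕜 (SeminormedCopy p) := inferInstanceAs (Module 𝕜 F)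

noncomputable instance (p : Seminorm 𝕜 F) : SeminormedAddCommGroup (SeminormedCopy p) :=
  AddGroupSeminorm.toSeminormedAddCommGroup p.toAddGroupSeminorm

noncomputable instance (p : Seminorm 𝕜 F) : NormedSpace 𝕜 (SeminormedCopy p) where
  norm_smul_le a b := (map_smul_eq_mul p a b).le

variable [TopologicalSpace F] [IsTopologicalAddGroup F]

/-- A continuous seminorm is the pullback of the norm of a Banach space. -/
theorem exists_banach_norm_eq (p : Seminorm 𝕜 F) (hp : Continuous p) :
    ∃ (B : Type v) (_ : NormedAddCommGroup B) (_ : NormedSpace 𝕜 B) (_ : CompleteSpace B)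
      (q : F →L[𝕜] B), ∀ y, ‖q y‖ = p y := by
  let i : F →ₗ[𝕜] SeminormedCopy p := LinearMap.id
  have hi : Continuous i := by
    refine continuous_of_continuousAt_zero i.toAddMonoidHom ?_
    have h : Tendsto (fun y : F => ‖i y‖) (𝓝 0) (𝓝 0) := by
      have := hp.tendsto 0
      rwa [map_zero] at this
    show Tendsto i (𝓝 0) (𝓝 (i 0))
    rw [map_zero]
    exact tendsto_zero_iff_norm_tendsto_zero.2 h
  refine ⟨UniformSpace.Completion (SeminormedCopy p), inferInstance, inferInstance, inferInstance,
    (UniformSpace.Completion.toComplL (𝕜 := 𝕜) (E := SeminormedCopy p)).comp ⟨i, hi⟩, fun y => ?_⟩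
  exact UniformSpace.Completion.norm_coe (E := SeminormedCopy p) (i y)

/-- Convergence in a locally convex space can be tested by continuous linear maps to Banach
spaces. -/
theorem tendsto_of_forall_banach [PolynormableSpace 𝕜 F] {α : Type*} {l : Filter α} {g : α → F}
    {y : F}
    (h : ∀ (B : Type v) [NormedAddCommGroup B] [NormedSpace 𝕜 B] [CompleteSpace B]
      (q : F →L[𝕜] B), Tendsto (fun a => q (g a)) l (𝓝 (q y))) : Tendsto g l (𝓝 y) := by
  rw [(PolynormableSpace.withSeminorms 𝕜 F).tendsto_nhds]
  rintro ⟨p, hp⟩ ε hε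
  obtain ⟨B, _, _, _, q, hq⟩ := exists_banach_norm_eq p hp
  have := (tendsto_iff_norm_sub_tendsto_zero.1 (h B q)).eventually (gt_mem_nhds hε)
  filter_upwards [this] with a ha
  rwa [← map_sub, hq] at ha

end Factorization

section DirDeriv

variable {𝕜 : Type} [RCLike 𝕜]
  {E : Type u} [AddCommGroup E] [Module 𝕜 E] [TopologicalSpace E] [IsTopologicalAddGroup E]
  [ContinuousSMul 𝕜 E]
  {F : Type v} [AddCommGroup F] [Module 𝕜 F] [TopologicalSpace F] [IsTopologicalAddGroup F]
  [ContinuousSMul 𝕜 F]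
  {f g : E → F} {U V : Set E} {x v : E} {y : F}

theorem _root_.HasDirDeriv.hasDerivAt {B : Type*} [NormedAddCommGroup B] [NormedSpace 𝕜 B]
    (q : F →L[𝕜] B) {s : 𝕜} (h : HasDirDeriv 𝕜 f (x + s • v) v y) :
    HasDerivAt (fun t : 𝕜 => q (f (x + t • v))) (q y) s := by
  rw [hasDerivAt_iff_tendsto_slope_zero]
  refine ((q.continuous.tendsto y).comp h).congr fun t => ?_
  simp only [Function.comp_apply, map_smul, map_sub, add_smul, add_assoc]

theorem _root_.HasDirDeriv.smul (h : HasDirDeriv 𝕜 f x v y) (a : 𝕜) :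
    HasDirDeriv 𝕜 f x (a • v) (a • y) := by
  rcases eq_or_ne a 0 with rfl | ha
  · simpa [HasDirDeriv] using tendsto_const_nhds
  have h1 : Tendsto (fun t : 𝕜 => t * a) (𝓝[≠] 0) (𝓝[≠] 0) := by
    refine tendsto_nhdsWithin_iff.2 ⟨?_, ?_⟩
    · exact ((continuous_mul_const a).tendsto' 0 0 (by simp)).mono_left nhdsWithin_le_nhds
    · filter_upwards [self_mem_nhdsWithin] with t ht
      exact mul_ne_zero ht ha
  refine ((h.comp h1).const_smul a).congr fun t => ?_
  simp only [Function.comp_apply, mul_inv, smul_smul]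
  rw [mul_comm t⁻¹, mul_inv_cancel_left₀ ha]

theorem _root_.HasDirDeriv.unique [T2Space F] {z : F} (h : HasDirDeriv 𝕜 f x v y)
    (h' : HasDirDeriv 𝕜 f x v z) : y = z :=
  tendsto_nhds_unique h h'

/-- Mean value inequality along a segment. -/
theorem norm_map_sub_le_of_hasDirDeriv {B : Type*} [NormedAddCommGroup B] [NormedSpace 𝕜 B]
    (q : F →L[𝕜] B) {d : ℝ → F} {c : B} {C : ℝ}
    (h : ∀ s ∈ Icc (0 : ℝ) 1, HasDirDeriv 𝕜 f (x + (s : 𝕜) • v) v (d s))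
    (hC : ∀ s ∈ Icc (0 : ℝ) 1, ‖q (d s) - c‖ ≤ C) :
    ‖q (f (x + v)) - q (f x) - c‖ ≤ C := by
  let _ : NormedSpace ℝ B := NormedSpace.restrictScalars ℝ 𝕜 B
  have : IsScalarTower ℝ 𝕜 B := IsScalarTower.of_algebraMap_smul fun _ _ => rfl
  have h1 : ∀ s ∈ Icc (0 : ℝ) 1,
      HasDerivWithinAt (fun s : ℝ => q (f (x + (s : 𝕜) • v)) - s • c) (q (d s) - c)
        (Icc (0 : ℝ) 1) s := by
    intro s hs
    have h2 := ((h s hs).hasDerivAt q).scomp_of_eq (x := s) (h := fun s : ℝ => (s : 𝕜))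
      (h' := (1 : 𝕜)) (by simpa using (RCLike.ofRealCLM (K := 𝕜)).hasDerivAt (x := s)) rfl
    rw [one_smul] at h2
    have h3 := (hasDerivAt_id s).smul_const c
    rw [one_smul] at h3
    exact (h2.sub h3).hasDerivWithinAt
  have := norm_image_sub_le_of_norm_deriv_le_segment_01' h1 fun s hs => hC s (Ico_subset_Icc_self hs)
  simpa [sub_right_comm] using this

/-- `df` is a continuous directional derivative of `f` on `U`. -/
structure HasContDirDeriv (𝕜 : Type) [RCLike 𝕜] {E : Type u} [AddCommGroup E] [Module 𝕜 E]
    [TopologicalSpace E] {F : Type v} [AddCommGroup F] [Module 𝕜 F] [TopologicalSpace F]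
    (f : E → F) (df : E × E → F) (U : Set E) : Prop where
  hasDirDeriv : ∀ x ∈ U, ∀ v, HasDirDeriv 𝕜 f x v (df (x, v))
  continuousOn : ContinuousOn df (U ×ˢ univ)

variable {df : E × E → F}

/-- A continuous directional derivative is a strict derivative. -/
theorem HasContDirDeriv.tendsto [PolynormableSpace 𝕜 F] (h : HasContDirDeriv 𝕜 f df U)
    (hU : IsOpen U) (hx : x ∈ U) {α : Type*} {l : Filter α} {t : α → 𝕜} {a b : α → E}
    (ht : Tendsto t l (𝓝[≠] 0)) (ha : Tendsto a l (𝓝 x)) (hb : Tendsto b l (𝓝 v)) :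
    Tendsto (fun i => (t i)⁻¹ • (f (a i + t i • b i) - f (a i))) l (𝓝 (df (x, v))) := by
  refine tendsto_of_forall_banach (𝕜 := 𝕜) fun B _ _ _ q => ?_
  rw [Metric.tendsto_nhds]
  intro ε hε
  -- Compactness of `[0, 1]` makes the estimate uniform along the whole segment from `a i` to `a i +
  -- t i • b i`, as the mean value inequality requires.
  have key : ∀ᶠ z : (𝕜 × E × E) in 𝓝 (0, x, v), ∀ s ∈ Icc (0 : ℝ) 1,
      z.2.1 + (s : 𝕜) • (z.1 • z.2.2) ∈ U ∧
      ‖q (df (z.2.1 + (s : 𝕜) • (z.1 • z.2.2), z.2.2)) - q (df (x, v))‖ < ε / 2 := by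
    refine isCompact_Icc.eventually_forall_of_forall_eventually fun s _ => ?_
    have hc : Tendsto (fun z : (𝕜 × E × E) × ℝ =>
        z.1.2.1 + (z.2 : 𝕜) • (z.1.1 • z.1.2.2)) (𝓝 ((0, x, v), s)) (𝓝 x) := by
      refine Continuous.tendsto' ?_ _ _ (by simp)
      exact (by fun_prop : Continuous fun z : (𝕜 × E × E) × ℝ => z.1.2.1).add
        ((RCLike.continuous_ofReal.comp continuous_snd).smul (by fun_prop))
    have hc2 : Tendsto (fun z : (𝕜 × E × E) × ℝ => z.1.2.2) (𝓝 ((0, x, v), s)) (𝓝 v) :=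
      Continuous.tendsto' (by fun_prop) _ _ rfl
    have hd : Tendsto (fun z => q (df z)) (𝓝 (x, v)) (𝓝 (q (df (x, v)))) :=
      (q.continuous.tendsto _).comp
        (h.continuousOn.continuousAt ((hU.prod isOpen_univ).mem_nhds ⟨hx, trivial⟩))
    have hd2 := tendsto_iff_norm_sub_tendsto_zero.1 (hd.comp (hc.prodMk_nhds hc2))
    exact (hc.eventually (hU.mem_nhds hx)).and (hd2.eventually (gt_mem_nhds (half_pos hε)))
  have hz : Tendsto (fun i => (t i, a i, b i)) l (𝓝 (0, x, v)) :=
    (tendsto_nhds_of_tendsto_nhdsWithin ht).prodMk_nhds (ha.prodMk_nhds hb)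
  filter_upwards [hz.eventually key, ht.eventually self_mem_nhdsWithin] with i hi hti
  have hti' : t i ≠ 0 := hti
  have hn : 0 < ‖t i‖ := norm_pos_iff.2 hti'
  have := norm_map_sub_le_of_hasDirDeriv (𝕜 := 𝕜) (f := f) (x := a i) (v := t i • b i) q
    (d := fun s => t i • df (a i + (s : 𝕜) • (t i • b i), b i)) (c := t i • q (df (x, v)))
    (C := ‖t i‖ * (ε / 2)) (fun s hs => ((h.hasDirDeriv _ (hi s hs).1 (b i)).smul (t i)))
    (fun s hs => by
      rw [map_smul, ← smul_sub, norm_smul]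
      exact mul_le_mul_of_nonneg_left (hi s hs).2.le hn.le)
  rw [dist_eq_norm, map_smul, map_sub]
  have h2 : (t i)⁻¹ • (q (f (a i + t i • b i)) - q (f (a i))) - q (df (x, v)) =
      (t i)⁻¹ • (q (f (a i + t i • b i)) - q (f (a i)) - t i • q (df (x, v))) := by
    rw [smul_sub _ _ (t i • _), inv_smul_smul₀ hti']
  rw [h2, norm_smul, norm_inv]
  calc ‖t i‖⁻¹ * _ ≤ ‖t i‖⁻¹ * (‖t i‖ * (ε / 2)) := by gcongr
    _ = ε / 2 := by field_simp
    _ < ε := half_lt_self hε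

/-- The increment `t (v₁ + v₂)` is made in two steps. The second starts at the moving point `x + t
v₁`, which is why the strict form of the derivative is needed. -/
theorem HasContDirDeriv.map_add [PolynormableSpace 𝕜 F] [T2Space F]
    (h : HasContDirDeriv 𝕜 f df U) (hU : IsOpen U) (hx : x ∈ U) (v₁ v₂ : E) :
    df (x, v₁ + v₂) = df (x, v₁) + df (x, v₂) := by
  have hid : Tendsto (fun t : 𝕜 => t) (𝓝[≠] 0) (𝓝[≠] 0) := tendsto_id
  have h0 : Tendsto (fun t : 𝕜 => t) (𝓝[≠] 0) (𝓝 0) := nhdsWithin_le_nhds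
  have ha : Tendsto (fun t : 𝕜 => x + t • v₁) (𝓝[≠] 0) (𝓝 x) := by
    simpa using tendsto_const_nhds.add (h0.smul_const v₁)
  have h1 := h.tendsto hU hx hid ha (tendsto_const_nhds (x := v₂))
  refine (tendsto_nhds_unique ((h.hasDirDeriv x hx v₁).add h1) ?_).symm
  refine (h.hasDirDeriv x hx (v₁ + v₂)).congr fun t => ?_
  rw [← smul_add, smul_add, add_assoc]
  congr 1
  abel

theorem _root_.HasDirDeriv.map_smul [T2Space F] {z : F} {a : 𝕜} (h : HasDirDeriv 𝕜 f x v y)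
    (h' : HasDirDeriv 𝕜 f x (a • v) z) : z = a • y := h'.unique (h.smul a)

/-- The value at `x` of a continuous directional derivative, as a continuous linear map. -/
theorem HasContDirDeriv.exists_clm [PolynormableSpace 𝕜 F] [T2Space F]
    (h : HasContDirDeriv 𝕜 f df U) (hU : IsOpen U) (hx : x ∈ U) :
    ∃ L : E →L[𝕜] F, ∀ v, L v = df (x, v) := by
  refine ⟨⟨⟨⟨fun v => df (x, v), h.map_add hU hx⟩, fun a v =>
    (h.hasDirDeriv x hx v).map_smul (h.hasDirDeriv x hx (a • v))⟩, ?_⟩, fun v => rfl⟩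
  exact continuousOn_univ.1 (h.continuousOn.comp (Continuous.continuousOn (by fun_prop))
    fun v _ => ⟨hx, trivial⟩)

end DirDeriv

end LocallyConvexCalculus

/-! ### Maps of class `C^k` over the real or complex numbers -/

namespace LocallyConvexCalculus

/-- The analogue of `CkOn` over the real or complex numbers. -/
def CkGen (𝕜 : Type) [RCLike 𝕜] {F : Type v} [AddCommGroup F] [Module 𝕜 F] [TopologicalSpace F] :
    (k : ℕ) → {E : Type u} → [AddCommGroup E] → [Module 𝕜 E] → [TopologicalSpace E] →
      (E → F) → Set E → Prop
  | 0, _, _, _, _, f, U => ContinuousOn f U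
  | k + 1, E, _, _, _, f, U => ContinuousOn f U ∧ ∃ df : E × E → F,
      (∀ x ∈ U, ∀ v : E, HasDirDeriv 𝕜 f x v (df (x, v))) ∧
        CkGen 𝕜 k df (U ×ˢ (univ : Set E))

theorem ckOn_iff_ckGen {F : Type v} [AddCommGroup F] [Module ℝ F] [TopologicalSpace F] {k : ℕ}
    {E : Type u} [AddCommGroup E] [Module ℝ E] [TopologicalSpace E] {f : E → F} {U : Set E} :
    CkOn k f U ↔ CkGen ℝ k f U := by
  induction k generalizing E with
  | zero => exact Iff.rfl
  | succ k ih =>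
    refine and_congr_right fun _ => exists_congr fun df => and_congr_right fun _ => ih

section

variable {𝕜 : Type} [RCLike 𝕜]
  {E : Type u} [AddCommGroup E] [Module 𝕜 E] [TopologicalSpace E] [IsTopologicalAddGroup E]
  [ContinuousSMul 𝕜 E]
  {F : Type v} [AddCommGroup F] [Module 𝕜 F] [TopologicalSpace F] [IsTopologicalAddGroup F]
  [ContinuousSMul 𝕜 F]
  {f g : E → F} {U V : Set E} {k : ℕ}

theorem CkGen.continuousOn (h : CkGen 𝕜 k f U) : ContinuousOn f U := by
  cases k with
  | zero => exact h
  | succ k => exact h.1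

theorem CkGen.mono (h : CkGen 𝕜 k f U) (hV : V ⊆ U) : CkGen 𝕜 k f V := by
  induction k generalizing E with
  | zero => exact ContinuousOn.mono h hV
  | succ k ih =>
    obtain ⟨h1, df, h2, h3⟩ := h
    exact ⟨h1.mono hV, df, fun x hx => h2 x (hV hx), ih h3 (prod_mono_left hV)⟩

theorem CkGen.of_succ (h : CkGen 𝕜 (k + 1) f U) : CkGen 𝕜 k f U := by
  induction k generalizing E with
  | zero => exact h.1
  | succ k ih =>
    obtain ⟨h1, df, h2, h3⟩ := h
    exact ⟨h1, df, h2, ih h3⟩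

theorem CkGen.exists_hasContDirDeriv (h : CkGen 𝕜 (k + 1) f U) :
    ∃ df : E × E → F, HasContDirDeriv 𝕜 f df U ∧ CkGen 𝕜 k df (U ×ˢ univ) := by
  obtain ⟨_, df, h2, h3⟩ := h
  exact ⟨df, ⟨h2, h3.continuousOn⟩, h3⟩

theorem eventually_add_smul_mem (hU : IsOpen U) {x : E} (hx : x ∈ U) (v : E) :
    ∀ᶠ t : 𝕜 in 𝓝 0, x + t • v ∈ U :=
  (Continuous.tendsto' (by fun_prop) (0 : 𝕜) x (by simp)).eventually (hU.mem_nhds hx)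

theorem _root_.HasDirDeriv.congr_of_eqOn {x v : E} {y : F} (hU : IsOpen U) (hx : x ∈ U)
    (h : HasDirDeriv 𝕜 f x v y) (hfg : EqOn f g U) : HasDirDeriv 𝕜 g x v y := by
  refine Tendsto.congr' ?_ h
  filter_upwards [nhdsWithin_le_nhds (eventually_add_smul_mem (𝕜 := 𝕜) hU hx v)] with t ht
  rw [hfg ht, hfg hx]

theorem CkGen.congr (h : CkGen 𝕜 k f U) (hU : IsOpen U) (hfg : EqOn f g U) : CkGen 𝕜 k g U := by
  cases k with
  | zero => exact ContinuousOn.congr h hfg.symm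
  | succ k =>
    obtain ⟨h1, df, h2, h3⟩ := h
    exact ⟨h1.congr hfg.symm, df, fun x hx v => (h2 x hx v).congr_of_eqOn hU hx hfg, h3⟩

/-- The derivative at `x` is taken from the neighbourhood chosen for `x`. Near a given point this
choice varies, but uniqueness of directional derivatives makes it agree with a single local
derivative. -/
theorem CkGen.of_local [T2Space F] (hU : IsOpen U)
    (h : ∀ x ∈ U, ∃ V, IsOpen V ∧ x ∈ V ∧ CkGen 𝕜 k f V) : CkGen 𝕜 k f U := by
  induction k generalizing E with
  | zero =>
    intro x hx
    obtain ⟨V, hV, hxV, hf⟩ := h x hx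
    exact (hf.continuousOn.continuousAt (hV.mem_nhds hxV)).continuousWithinAt
  | succ k ih =>
    choose! V hV hxV hf using h
    choose! df hdf using fun x hx => (hf x hx).exists_hasContDirDeriv
    refine ⟨fun x hx => ((hf x hx).continuousOn.continuousAt
      ((hV x hx).mem_nhds (hxV x hx))).continuousWithinAt, fun z => df z.1 z, fun x hx v =>
      (hdf x hx).1.hasDirDeriv x (hxV x hx) v, ih (hU.prod isOpen_univ) ?_⟩
    rintro ⟨x, v⟩ ⟨hx, -⟩
    refine ⟨(V x ∩ U) ×ˢ univ, ((hV x hx).inter hU).prod isOpen_univ, ⟨⟨hxV x hx, hx⟩, trivial⟩,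
      ((hdf x hx).2.mono (prod_mono_left inter_subset_left)).congr
        (((hV x hx).inter hU).prod isOpen_univ) ?_⟩
    rintro ⟨y, w⟩ ⟨⟨hyV, hyU⟩, -⟩
    exact ((hdf x hx).1.hasDirDeriv y hyV w).unique ((hdf y hyU).1.hasDirDeriv y (hxV y hyU) w)

theorem CkGen.clm (A : E →L[𝕜] F) : CkGen 𝕜 k A U := by
  induction k generalizing E with
  | zero => exact A.continuous.continuousOn
  | succ k ih =>
    refine ⟨A.continuous.continuousOn, A.comp (ContinuousLinearMap.snd 𝕜 E E), fun x _ v => ?_,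
      ih _⟩
    refine Tendsto.congr' ?_ tendsto_const_nhds
    filter_upwards [self_mem_nhdsWithin] with t ht
    have ht' : t ≠ 0 := ht
    simp [inv_smul_smul₀ ht']

theorem CkGen.prodMk {G : Type w} [AddCommGroup G] [Module 𝕜 G] [TopologicalSpace G]
    {g : E → G} (hf : CkGen 𝕜 k f U) (hg : CkGen 𝕜 k g U) :
    CkGen 𝕜 k (fun x => (f x, g x)) U := by
  induction k generalizing E with
  | zero => exact ContinuousOn.prodMk hf hg
  | succ k ih =>
    obtain ⟨h1, df, h2, h3⟩ := hf
    obtain ⟨g1, dg, g2, g3⟩ := hg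
    exact ⟨h1.prodMk g1, fun z => (df z, dg z), fun x hx v =>
      (h2 x hx v).prodMk_nhds (g2 x hx v), ih h3 g3⟩

/-- Precomposition with a linear map needs no local convexity. It precedes the general chain rule,
whose induction uses it to regard `f` as a function on `E × E`. -/
theorem CkGen.comp_clm {G : Type w} [AddCommGroup G] [Module 𝕜 G] [TopologicalSpace G]
    {g : F → G} {V : Set F} (hg : CkGen 𝕜 k g V) (A : E →L[𝕜] F) (hA : MapsTo A U V) :
    CkGen 𝕜 k (fun x => g (A x)) U := by
  induction k generalizing E F with
  | zero => exact ContinuousOn.comp hg A.continuous.continuousOn hA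
  | succ k ih =>
    obtain ⟨h1, dg, h2, h3⟩ := hg
    refine ⟨h1.comp A.continuous.continuousOn hA, fun z => dg (A.prodMap A z), fun x hx v => ?_,
      ih h3 _ fun z hz => ⟨hA hz.1, trivial⟩⟩
    exact Tendsto.congr (fun t => by simp) (h2 (A x) (hA hx) (A v))

/-- The increment of `f` is `t` times its difference quotient, a convergent direction, so strict
differentiability of `g` yields the limit. The derivative is the composite of `dg` with `(f ∘ fst,
df)`, to which the induction hypothesis applies. -/
theorem CkGen.comp {G : Type w} [AddCommGroup G] [Module 𝕜 G] [TopologicalSpace G]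
    [IsTopologicalAddGroup G] [ContinuousSMul 𝕜 G] [PolynormableSpace 𝕜 G] {g : F → G}
    {V : Set F} (hg : CkGen 𝕜 k g V) (hf : CkGen 𝕜 k f U) (hV : IsOpen V) (hfV : MapsTo f U V) :
    CkGen 𝕜 k (fun x => g (f x)) U := by
  induction k generalizing E F with
  | zero => exact ContinuousOn.comp hg hf hfV
  | succ k ih =>
    obtain ⟨dg, hdg, hdg'⟩ := hg.exists_hasContDirDeriv
    obtain ⟨df, hdf, hdf'⟩ := hf.exists_hasContDirDeriv
    refine ⟨hg.continuousOn.comp hf.continuousOn hfV, fun z => dg (f z.1, df z), ?_, ?_⟩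
    · intro x hx v
      refine (hdg.tendsto hV (hfV hx) tendsto_id tendsto_const_nhds
        (hdf.hasDirDeriv x hx v)).congr' ?_
      filter_upwards [self_mem_nhdsWithin] with t ht
      have ht' : t ≠ 0 := ht
      simp [smul_inv_smul₀ ht']
    · exact ih hdg' ((hf.of_succ.comp_clm (ContinuousLinearMap.fst 𝕜 E E) fun z hz => hz.1).prodMk
        hdf') (hV.prod isOpen_univ) fun z hz => ⟨hfV hz.1, trivial⟩

theorem CkGen.add [PolynormableSpace 𝕜 F] (hf : CkGen 𝕜 k f U) (hg : CkGen 𝕜 k g U) :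
    CkGen 𝕜 k (fun x => f x + g x) U :=
  (CkGen.clm (U := univ) (ContinuousLinearMap.fst 𝕜 F F + ContinuousLinearMap.snd 𝕜 F F)).comp
    (hf.prodMk hg) isOpen_univ (mapsTo_univ _ _)

/-- A map is `C^k` if its composition with a linear closed embedding is `C^k`. -/
theorem CkGen.of_comp_isClosedEmbedding [T2Space F] {G : Type w} [AddCommGroup G] [Module 𝕜 G]
    [TopologicalSpace G] [IsTopologicalAddGroup G] [ContinuousSMul 𝕜 G]
    (J : F →L[𝕜] G) (hJ : IsClosedEmbedding J) (hU : IsOpen U)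
    (h : CkGen 𝕜 k (fun x => J (f x)) U) : CkGen 𝕜 k f U := by
  induction k generalizing E with
  | zero => exact hJ.isInducing.continuousOn_iff.2 h
  | succ k ih =>
    obtain ⟨h1, d, h2, h3⟩ := h
    -- The difference quotients lie in the range of `J`; closedness keeps their limits there.
    have hd : ∀ z ∈ U ×ˢ (univ : Set E), ∃ y, J y = d z := by
      rintro ⟨x, v⟩ ⟨hx, -⟩
      refine hJ.isClosed_range.mem_of_tendsto (h2 x hx v) (Eventually.of_forall fun t => ?_)
      exact ⟨t⁻¹ • (f (x + t • v) - f x), by simp⟩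
    choose! df hdf using hd
    refine ⟨hJ.isInducing.continuousOn_iff.2 h1, df, fun x hx v => ?_,
      ih (hU.prod isOpen_univ) (h3.congr (hU.prod isOpen_univ) fun z hz => (hdf z hz).symm)⟩
    refine hJ.isInducing.tendsto_nhds_iff.2 ?_
    rw [hdf (x, v) ⟨hx, trivial⟩]
    exact Tendsto.congr (fun t => by simp) (h2 x hx v)

end

end LocallyConvexCalculus

/-! ### Pointwise convergent power series -/

namespace LocallyConvexCalculus

section OneVariable

variable {B : Type*} [NormedAddCommGroup B] [NormedSpace ℂ B] [CompleteSpace B]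

/-- A pointwise convergent power series in one complex variable is a power series expansion. -/
theorem hasFPowerSeriesOnBall_of_tendsto {a : ℕ → B} {h : ℂ → B} {R : ℝ} (hR : 0 < R)
    (hh : ∀ z ∈ Metric.ball (0 : ℂ) R,
      Tendsto (fun m => ∑ n ∈ Finset.range m, z ^ n • a n) atTop (𝓝 (h z))) :
    HasFPowerSeriesOnBall h (fun n => ContinuousMultilinearMap.mkPiRing ℂ (Fin n) (a n)) 0
      (ENNReal.ofReal R) := by
  set p : FormalMultilinearSeries ℂ ℂ B :=
    fun n => ContinuousMultilinearMap.mkPiRing ℂ (Fin n) (a n) with hp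
  have hpn : ∀ n (z : ℂ), (p n fun _ => z) = z ^ n • a n := fun n z => by simp [hp]
  have hrad : ENNReal.ofReal R ≤ p.radius := by
    refine ENNReal.le_of_forall_nnreal_lt fun r hr => ?_
    refine p.le_radius_of_tendsto (l := 0) ?_
    have hr' : (r : ℝ) < R := by
      rw [ENNReal.lt_ofReal_iff_toReal_lt ENNReal.coe_ne_top] at hr
      exact hr
    have hz : ((r : ℝ) : ℂ) ∈ Metric.ball (0 : ℂ) R := by simpa using hr'
    -- Consecutive partial sums differ by one term, so the terms at `z = r` tend to zero, which
    -- bounds the radius of convergence from below.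
    have h1 := (hh _ hz).comp (tendsto_add_atTop_nat 1) |>.sub (hh _ hz)
    simp only [Function.comp_def, Finset.sum_range_succ, add_sub_cancel_left, sub_self] at h1
    have h2 := h1.norm
    simp only [norm_smul, norm_pow, norm_zero] at h2
    refine h2.congr fun n => ?_
    rw [hp, ContinuousMultilinearMap.norm_mkPiRing, mul_comm]
    simp
  refine ⟨hrad, ENNReal.ofReal_pos.2 hR, fun {y} hy => ?_⟩
  have hy' : y ∈ Metric.ball (0 : ℂ) R := by rwa [Metric.eball_ofReal] at hy
  have hs : Summable fun n => p n fun _ => y :=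
    p.summable (Metric.eball_subset_eball hrad hy)
  have h1 := hs.hasSum.tendsto_sum_nat
  have h2 := hh y hy'
  simp only [hpn] at h1 ⊢
  rw [zero_add, tendsto_nhds_unique h2 h1]
  simpa only [hpn] using hs.hasSum

theorem hasDerivAt_of_tendsto_series {a : ℕ → B} {h : ℂ → B} {R : ℝ} (hR : 0 < R)
    (hh : ∀ z ∈ Metric.ball (0 : ℂ) R,
      Tendsto (fun m => ∑ n ∈ Finset.range m, z ^ n • a n) atTop (𝓝 (h z))) :
    HasDerivAt h (a 1) 0 := by
  simpa using (hasFPowerSeriesOnBall_of_tendsto hR hh).hasFPowerSeriesAt.hasDerivAt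

/-- Cauchy's estimate for the coefficients of a power series. -/
theorem norm_coeff_le_of_tendsto_series {a : ℕ → B} {h : ℂ → B} {R r C : ℝ} (hr : 0 < r)
    (hrR : r < R)
    (hh : ∀ z ∈ Metric.ball (0 : ℂ) R,
      Tendsto (fun m => ∑ n ∈ Finset.range m, z ^ n • a n) atTop (𝓝 (h z)))
    (hC : ∀ z ∈ Metric.sphere (0 : ℂ) r, ‖h z‖ ≤ C) (n : ℕ) : ‖a n‖ ≤ C / r ^ n := by
  have hp := hasFPowerSeriesOnBall_of_tendsto (hr.trans hrR) hh
  have h1 := hp.factorial_smul 1 n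
  rw [← iteratedDeriv_eq_iteratedFDeriv] at h1
  have h2 : DiffContOnCl ℂ h (Metric.ball 0 r) := by
    refine DifferentiableOn.diffContOnCl ?_
    refine hp.differentiableOn.mono ?_
    rw [Metric.eball_ofReal]
    exact Metric.closure_ball_subset_closedBall.trans (Metric.closedBall_subset_ball hrR)
  have h3 := Complex.norm_iteratedDeriv_le_of_forall_mem_sphere_norm_le n hr h2 hC
  rw [← h1] at h3
  simp only [ContinuousMultilinearMap.mkPiRing_apply, Finset.prod_const_one, one_smul] at h3
  rw [← Nat.cast_smul_eq_nsmul ℝ, norm_smul, Real.norm_natCast, mul_div_assoc] at h3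
  exact le_of_mul_le_mul_left h3 (by positivity)

end OneVariable

section Analytic

variable
  {E : Type u} [AddCommGroup E] [Module ℂ E] [TopologicalSpace E] [IsTopologicalAddGroup E]
  [ContinuousSMul ℂ E]
  {F : Type v} [AddCommGroup F] [Module ℂ F] [TopologicalSpace F] [IsTopologicalAddGroup F]
  [ContinuousSMul ℂ F]
  {f : E → F} {U : Set E}

theorem map_const_smul {n : ℕ} (p : ContinuousMultilinearMap ℂ (fun _ : Fin n => E) F) (z : ℂ)
    (y : E) : (p fun _ => z • y) = z ^ n • p fun _ => y := by
  simpa using p.map_smul_univ (fun _ => z) (fun _ => y)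

theorem tendsto_one_variable {x : E} {V : Set E}
    {p : (n : ℕ) → ContinuousMultilinearMap ℂ (fun _ : Fin n => E) F}
    (hp : ∀ y ∈ V, Tendsto (fun m : ℕ => ∑ n ∈ Finset.range m, p n (fun _ => y)) atTop
      (𝓝 (f (x + y)))) {B : Type*} [NormedAddCommGroup B] [NormedSpace ℂ B] (q : F →L[ℂ] B)
    {z : ℂ} {y : E} (hz : z • y ∈ V) :
    Tendsto (fun m => ∑ n ∈ Finset.range m, z ^ n • q (p n fun _ => y)) atTop
      (𝓝 (q (f (x + z • y)))) := by
  refine ((q.continuous.tendsto _).comp (hp _ hz)).congr fun m => ?_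
  simp [map_const_smul]

theorem hasDirDeriv_of_series [PolynormableSpace ℂ F] {x : E} {V : Set E} (hV : V ∈ 𝓝 0)
    {p : (n : ℕ) → ContinuousMultilinearMap ℂ (fun _ : Fin n => E) F}
    (hp : ∀ y ∈ V, Tendsto (fun m : ℕ => ∑ n ∈ Finset.range m, p n (fun _ => y)) atTop
      (𝓝 (f (x + y)))) (v : E) : HasDirDeriv ℂ f x v (p 1 fun _ => v) := by
  refine tendsto_of_forall_banach (𝕜 := ℂ) fun B _ _ _ q => ?_
  have h1 : ∀ᶠ z : ℂ in 𝓝 0, z • v ∈ V :=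
    (Continuous.tendsto' (by fun_prop) (0 : ℂ) 0 (by simp)).eventually hV
  obtain ⟨R, hR, hRV⟩ := Metric.eventually_nhds_iff_ball.1 h1
  have h2 := hasDerivAt_of_tendsto_series (h := fun z => q (f (x + z • v)))
    (a := fun n => q (p n fun _ => v)) hR fun z hz => tendsto_one_variable hp q (hRV z hz)
  rw [hasDerivAt_iff_tendsto_slope_zero] at h2
  refine h2.congr fun t => by simp

/-- Since `E` carries no norm, `p` is pulled back along `(a, s) ↦ a y + s v` to the normed space `ℂ
× ℂ`, where multilinear maps have Fréchet derivatives. -/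
theorem hasDerivAt_line {n : ℕ} (p : ContinuousMultilinearMap ℂ (fun _ : Fin n => E) F)
    {B : Type*} [NormedAddCommGroup B] [NormedSpace ℂ B] (q : F →L[ℂ] B) (y v : E) (s : ℂ) :
    HasDerivAt (fun s : ℂ => q (p fun _ => y + s • v))
      (q (p.linearDeriv (fun _ => y + s • v) fun _ => v)) s := by
  let Λ : ℂ × ℂ →L[ℂ] E := (ContinuousLinearMap.fst ℂ ℂ ℂ).smulRight y +
    (ContinuousLinearMap.snd ℂ ℂ ℂ).smulRight v
  let M := (q.compContinuousMultilinearMap p).compContinuousLinearMap fun _ : Fin n => Λ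
  have h1 : HasDerivAt (fun s : ℂ => fun _ : Fin n => ((1, s) : ℂ × ℂ)) (fun _ => (0, 1)) s :=
    hasDerivAt_pi.2 fun _ => (hasDerivAt_const s (1 : ℂ)).prodMk (hasDerivAt_id s)
  have h2 := (M.hasFDerivAt fun _ => ((1, s) : ℂ × ℂ)).comp_hasDerivAt s h1
  refine (h2.congr_deriv ?_).congr_of_eventuallyEq (Eventually.of_forall fun t => ?_)
  · rw [ContinuousMultilinearMap.linearDeriv_apply, ContinuousMultilinearMap.linearDeriv_apply,
      map_sum]
    refine Finset.sum_congr rfl fun i _ => ?_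
    simp only [M, ContinuousMultilinearMap.compContinuousLinearMap_apply,
      ContinuousLinearMap.compContinuousMultilinearMap_coe, Function.comp_apply]
    congr 2
    ext j
    rcases eq_or_ne j i with rfl | hj
    · simp [Λ]
    · simp [Λ, hj]
  · simp [M, Λ]

/-- The derivative of a complex analytic map is given by the differentiated series. -/
theorem tendsto_deriv_series [PolynormableSpace ℂ F] {x : E} {V : Set E} (hV : IsOpen V)
    (hf : ContinuousOn f ((fun y => x + y) '' V))
    {p : (n : ℕ) → ContinuousMultilinearMap ℂ (fun _ : Fin n => E) F}
    (hp : ∀ y ∈ V, Tendsto (fun m : ℕ => ∑ n ∈ Finset.range m, p n (fun _ => y)) atTop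
      (𝓝 (f (x + y)))) {y : E} (hy : ∀ ζ ∈ Metric.closedBall (0 : ℂ) 2, ζ • y ∈ V) (v : E) {d : F}
    (hd : HasDirDeriv ℂ f (x + y) v d) :
    Tendsto (fun m => ∑ n ∈ Finset.range m, (p n).linearDeriv (fun _ => y) fun _ => v) atTop
      (𝓝 d) := by
  refine tendsto_of_forall_banach (𝕜 := ℂ) fun B _ _ _ q => ?_
  have hxV : ContinuousOn (fun y => q (f (x + y))) V :=
    q.continuous.comp_continuousOn (hf.comp (by fun_prop) fun z hz => ⟨z, hz, rfl⟩)
  obtain ⟨C, hC⟩ := (isCompact_closedBall (0 : ℂ) 2).exists_bound_of_continuousOn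
    (f := fun ζ : ℂ => q (f (x + ζ • y))) (hxV.comp (by fun_prop) hy)
  have key : ∀ᶠ s : ℂ in 𝓝 0, ∀ ζ ∈ Metric.closedBall (0 : ℂ) 2,
      ζ • (y + s • v) ∈ V ∧ ‖q (f (x + ζ • (y + s • v)))‖ < C + 1 := by
    refine (isCompact_closedBall (0 : ℂ) 2).eventually_forall_of_forall_eventually fun ζ hζ => ?_
    have h1 : Tendsto (fun z : ℂ × ℂ => z.2 • (y + z.1 • v)) (𝓝 (0, ζ)) (𝓝 (ζ • y)) :=
      Continuous.tendsto' (by fun_prop) _ _ (by simp)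
    have h2 := (((hxV.continuousAt (hV.mem_nhds (hy ζ hζ))).tendsto).comp h1).norm
    exact (h1.eventually (hV.mem_nhds (hy ζ hζ))).and
      (h2.eventually (gt_mem_nhds ((hC ζ hζ).trans_lt (lt_add_one C))))
  obtain ⟨δ, hδ, hδV⟩ := Metric.eventually_nhds_iff_ball.1 key
  -- The room up to radius `2` permits Cauchy's estimate at radius `3 / 2 > 1`. The resulting
  -- geometric bound is uniform in `s` and justifies termwise differentiation.
  have hb : ∀ n, ∀ s ∈ Metric.ball (0 : ℂ) δ,
      ‖q (p n fun _ => y + s • v)‖ ≤ (C + 1) / (3 / 2 : ℝ) ^ n := by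
    intro n s hs
    refine norm_coeff_le_of_tendsto_series (R := 2) (r := 3 / 2)
      (a := fun n => q (p n fun _ => y + s • v)) (h := fun ζ => q (f (x + ζ • (y + s • v))))
      (by norm_num) (by norm_num)
      (fun z hz => tendsto_one_variable hp q (hδV s hs z (Metric.ball_subset_closedBall hz)).1)
      (fun z hz => (hδV s hs z ?_).2.le) n
    exact Metric.sphere_subset_closedBall.trans (Metric.closedBall_subset_closedBall (by norm_num))
      hz
  have hu : Summable fun n : ℕ => (C + 1) / (3 / 2 : ℝ) ^ n := by
    simp_rw [div_eq_mul_inv, ← inv_pow]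
    exact (summable_geometric_of_lt_one (by norm_num) (by norm_num)).mul_left _
  have hsum := Complex.hasSum_deriv_of_summable_norm hu
    (fun n s _ => (hasDerivAt_line (p n) q y v s).differentiableAt.differentiableWithinAt)
    Metric.isOpen_ball hb (Metric.mem_ball_self hδ)
  have htsum : ∀ s ∈ Metric.ball (0 : ℂ) δ,
      ∑' n, q (p n fun _ => y + s • v) = q (f (x + y + s • v)) := by
    intro s hs
    have h1 := (Summable.of_norm_bounded hu fun n => hb n s hs).hasSum.tendsto_sum_nat
    have h2 := tendsto_one_variable hp q (z := 1) (y := y + s • v)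
      (hδV s hs 1 (by simp)).1
    simp only [one_pow, one_smul] at h2
    rw [tendsto_nhds_unique h1 h2, add_assoc]
  have hderiv : HasDerivAt (fun s : ℂ => ∑' n, q (p n fun _ => y + s • v)) (q d) 0 := by
    have h1 : HasDirDeriv ℂ f (x + y + (0 : ℂ) • v) v d := by simpa using hd
    refine (h1.hasDerivAt q).congr_of_eventuallyEq ?_
    filter_upwards [Metric.ball_mem_nhds (0 : ℂ) hδ] with s hs using htsum s hs
  rw [hderiv.deriv] at hsum
  refine hsum.tendsto_sum_nat.congr fun m => ?_
  rw [map_sum]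
  refine Finset.sum_congr rfl fun n _ => ?_
  rw [(hasDerivAt_line (p n) q y v 0).deriv]
  simp

end Analytic

end LocallyConvexCalculus

/-! ### Complex analytic maps are smooth over `ℂ` -/

namespace LocallyConvexCalculus

section Analytic

variable
  {E : Type u} [AddCommGroup E] [Module ℂ E] [TopologicalSpace E] [IsTopologicalAddGroup E]
  [ContinuousSMul ℂ E]
  {F : Type v} [AddCommGroup F] [Module ℂ F] [TopologicalSpace F] [IsTopologicalAddGroup F]
  [ContinuousSMul ℂ F]
  {f : E → F} {U : Set E}

/-- Insertion of a fixed vector as the `j`-th argument of a continuous multilinear map. -/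
def insertArg {n : ℕ} (p : ContinuousMultilinearMap ℂ (fun _ : Fin (n + 1) => E) F)
    (j : Fin (n + 1)) (v : E) : ContinuousMultilinearMap ℂ (fun _ : Fin n => E) F where
  toFun y := p (j.insertNth v y)
  map_update_add' y i a b := by
    have h : ‹DecidableEq (Fin n)› = instDecidableEqFin n := Subsingleton.elim _ _
    subst h
    simp only [Fin.insertNth_update, p.map_update_add]
  map_update_smul' y i c a := by
    have h : ‹DecidableEq (Fin n)› = instDecidableEqFin n := Subsingleton.elim _ _
    subst h
    simp only [Fin.insertNth_update, p.map_update_smul]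
  cont := p.cont.comp (Continuous.finInsertNth j continuous_const continuous_id)

/-- The homogeneous polynomial `y ↦ D(βₙ)(y) v`, of degree `n - 1`, as a multilinear map. -/
def derivAt {n : ℕ} (p : ContinuousMultilinearMap ℂ (fun _ : Fin (n + 1) => E) F) (v : E) :
    ContinuousMultilinearMap ℂ (fun _ : Fin n => E) F :=
  ∑ j, insertArg p j v

theorem derivAt_diag {n : ℕ} (p : ContinuousMultilinearMap ℂ (fun _ : Fin (n + 1) => E) F)
    (v y : E) : (derivAt p v fun _ => y) = p.linearDeriv (fun _ => y) fun _ => v := by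
  rw [derivAt, sum_apply, ContinuousMultilinearMap.linearDeriv_apply]
  refine Finset.sum_congr rfl fun j _ => ?_
  show p (j.insertNth v fun _ => y) = _
  congr 1
  rw [Fin.insertNth_eq_iff]
  refine ⟨by simp, ?_⟩
  ext i
  simp [Fin.removeNth]

/-- The homogeneous polynomial `(y, v) ↦ D(βₙ)(y) v`, of degree `n`, as a multilinear map. -/
def derivPair {n : ℕ} (p : ContinuousMultilinearMap ℂ (fun _ : Fin n => E) F) :
    ContinuousMultilinearMap ℂ (fun _ : Fin n => E × E) F :=
  ∑ j : Fin n, p.compContinuousLinearMap fun i =>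
    if i = j then ContinuousLinearMap.snd ℂ E E else ContinuousLinearMap.fst ℂ E E

theorem derivPair_diag {n : ℕ} (p : ContinuousMultilinearMap ℂ (fun _ : Fin n => E) F)
    (y v : E) : (derivPair p fun _ => (y, v)) = p.linearDeriv (fun _ => y) fun _ => v := by
  rw [derivPair, sum_apply, ContinuousMultilinearMap.linearDeriv_apply]
  refine Finset.sum_congr rfl fun j _ => ?_
  rw [ContinuousMultilinearMap.compContinuousLinearMap_apply]
  congr 1
  ext i
  rcases eq_or_ne i j with rfl | hj
  · simp
  · simp [hj]

/-- The directional derivative of a continuous map which is complex differentiable in every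
direction is continuous. -/
theorem continuousOn_dirDeriv [PolynormableSpace ℂ F] (hU : IsOpen U) (hf : ContinuousOn f U)
    {df : E × E → F} (hdf : ∀ x ∈ U, ∀ v, HasDirDeriv ℂ f x v (df (x, v))) :
    ContinuousOn df (U ×ˢ univ) := by
  rintro ⟨x, v⟩ ⟨hx, -⟩
  refine ContinuousAt.continuousWithinAt ?_
  refine tendsto_of_forall_banach (𝕜 := ℂ) fun B _ _ _ q => ?_
  obtain ⟨R, hR, hRU⟩ := Metric.eventually_nhds_iff_ball.1 (eventually_add_smul_mem (𝕜 := ℂ) hU hx v)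
  set r := R / 2 with hr
  have hr0 : 0 < r := half_pos hR
  have hrR : Metric.closedBall (0 : ℂ) r ⊆ Metric.ball 0 R :=
    Metric.closedBall_subset_ball (half_lt_self hR)
  rw [Metric.tendsto_nhds]
  intro ε hε
  have key : ∀ᶠ z : E × E in 𝓝 (x, v), ∀ s ∈ Metric.closedBall (0 : ℂ) r,
      z.1 + s • z.2 ∈ U ∧ ‖q (f (z.1 + s • z.2)) - q (f (x + s • v))‖ < ε / 2 * r := by
    refine (isCompact_closedBall (0 : ℂ) r).eventually_forall_of_forall_eventually fun s hs => ?_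
    have hsU := hU.mem_nhds (hRU s (hrR hs))
    have h1 : Tendsto (fun z : (E × E) × ℂ => z.1.1 + z.2 • z.1.2) (𝓝 ((x, v), s))
        (𝓝 (x + s • v)) := Continuous.tendsto' (by fun_prop) _ _ rfl
    have h2 : Tendsto (fun z : (E × E) × ℂ => x + z.2 • v) (𝓝 ((x, v), s))
        (𝓝 (x + s • v)) := Continuous.tendsto' (by fun_prop) _ _ rfl
    have hq : Tendsto (fun y => q (f y)) (𝓝 (x + s • v)) (𝓝 (q (f (x + s • v)))) :=
      (q.continuous.tendsto _).comp (hf.continuousAt hsU)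
    have h3 := ((hq.comp h1).sub (hq.comp h2)).norm
    rw [sub_self, norm_zero] at h3
    exact (h1.eventually hsU).and (h3.eventually (gt_mem_nhds (by positivity)))
  filter_upwards [key] with z hz
  have hd : ∀ s ∈ Metric.closedBall (0 : ℂ) r,
      HasDerivAt (fun s : ℂ => q (f (z.1 + s • z.2)) - q (f (x + s • v)))
        (q (df (z.1 + s • z.2, z.2)) - q (df (x + s • v, v))) s := fun s hs =>
    ((hdf _ (hz s hs).1 _).hasDerivAt q).sub ((hdf _ (hRU s (hrR hs)) _).hasDerivAt q)
  have h0 := hd 0 (Metric.mem_closedBall_self hr0.le)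
  -- Cauchy's estimate on the circle of radius `r`, applied to the difference of the restrictions of
  -- `q ∘ f` to two nearby lines; the factor `r` in the bound cancels the division by the radius.
  have h4 := Complex.norm_deriv_le_of_forall_mem_sphere_norm_le hr0
    (DifferentiableOn.diffContOnCl fun s hs =>
      (hd s (Metric.closure_ball_subset_closedBall hs)).differentiableAt.differentiableWithinAt)
    (fun s hs => (hz s (Metric.sphere_subset_closedBall hs)).2.le)
  rw [h0.deriv, mul_div_cancel_right₀ _ hr0.ne'] at h4
  simp only [zero_smul, add_zero] at h4
  rw [dist_eq_norm]
  exact h4.trans_lt (half_lt_self hε)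

/-- The differential of a complex analytic map is complex analytic. -/
theorem _root_.ComplexAnalyticOn.exists_deriv [PolynormableSpace ℂ F] [T2Space F] (hU : IsOpen U)
    (h : ComplexAnalyticOn f U) : ∃ df : E × E → F,
      HasContDirDeriv ℂ f df U ∧ ComplexAnalyticOn df (U ×ˢ univ) := by
  obtain ⟨hf, hp⟩ := h
  have hp' := hp
  choose! p V hV hpV using hp
  have hd : ∀ x ∈ U, ∀ v, HasDirDeriv ℂ f x v (p x 1 fun _ => v) := fun x hx v =>
    hasDirDeriv_of_series (hV x hx) (fun y hy => (hpV x hx y hy).2) v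
  let df : E × E → F := fun z => p z.1 1 fun _ => z.2
  have hdf : ContinuousOn df (U ×ˢ univ) := continuousOn_dirDeriv hU hf hd
  have hdf' : HasContDirDeriv ℂ f df U := ⟨hd, hdf⟩
  refine ⟨df, hdf', hdf, ?_⟩
  rintro ⟨x, v⟩ ⟨hx, -⟩
  obtain ⟨V', hV'V, hV', h0⟩ := mem_nhds_iff.1 (hV x hx)
  have hser := fun y hy => (hpV x hx y (hV'V hy)).2
  have hfV : ContinuousOn f ((fun y => x + y) '' V') := by
    refine hf.mono ?_
    rintro _ ⟨y, hy, rfl⟩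
    exact (hpV x hx y (hV'V hy)).1
  have hW : ∀ᶠ y : E in 𝓝 0, ∀ ζ ∈ Metric.closedBall (0 : ℂ) 2, ζ • y ∈ V' := by
    refine (isCompact_closedBall (0 : ℂ) 2).eventually_forall_of_forall_eventually fun ζ _ => ?_
    exact (Continuous.tendsto' (f := fun z : E × ℂ => z.2 • z.1) (by fun_prop) (0, ζ) 0
      (by simp)).eventually (hV'.mem_nhds h0)
  -- By additivity `df (x + y, v + w)` splits. In the `v`-part the direction is fixed and
  -- differentiation lowers the degree, whence `n + 1`; in the `w`-part the direction belongs to the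
  -- increment and the degree is kept.
  refine ⟨fun n => (derivAt (p x (n + 1)) v).compContinuousLinearMap
    (fun _ => ContinuousLinearMap.fst ℂ E E) + derivPair (p x n),
    {y | ∀ ζ ∈ Metric.closedBall (0 : ℂ) 2, ζ • y ∈ V'} ×ˢ univ, ?_, ?_⟩
  · rw [← Prod.mk_zero_zero]
    exact prod_mem_nhds hW univ_mem
  · rintro ⟨y, w⟩ ⟨hy, -⟩
    have hyV : y ∈ V' := by simpa using hy 1 (by simp)
    have hyU : x + y ∈ U := (hpV x hx y (hV'V hyV)).1
    refine ⟨⟨hyU, trivial⟩, ?_⟩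
    -- The shift matches the lowered degree: the extra term, of degree zero, has derivative zero.
    have h1 := (tendsto_deriv_series hV' hfV hser hy v (hd _ hyU v)).comp (tendsto_add_atTop_nat 1)
    have h2 := tendsto_deriv_series hV' hfV hser hy w (hd _ hyU w)
    have h3 := h1.add h2
    rw [← hdf'.map_add hU hyU v w] at h3
    refine h3.congr fun m => ?_
    simp only [Function.comp_apply, Finset.sum_range_succ', add_apply,
      Finset.sum_add_distrib, derivPair_diag, ContinuousMultilinearMap.compContinuousLinearMap_apply,
      ContinuousLinearMap.coe_fst', derivAt_diag, add_left_inj]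
    simp [ContinuousMultilinearMap.linearDeriv_apply]

theorem _root_.ComplexAnalyticOn.ckGen [PolynormableSpace ℂ F] [T2Space F] (hU : IsOpen U)
    (h : ComplexAnalyticOn f U) (k : ℕ) : CkGen ℂ k f U := by
  induction k generalizing E with
  | zero => exact h.1
  | succ k ih =>
    obtain ⟨df, h1, h2⟩ := h.exists_deriv hU
    exact ⟨h.1, df, h1.hasDirDeriv, ih (hU.prod isOpen_univ) h2⟩

end Analytic

end LocallyConvexCalculus

/-! ### Taylor series: smooth maps over `ℂ` are complex analytic -/

namespace LocallyConvexCalculus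

section Taylor

variable
  {E : Type u} [AddCommGroup E] [Module ℂ E] [TopologicalSpace E] [IsTopologicalAddGroup E]
  [ContinuousSMul ℂ E]
  {F : Type v} [AddCommGroup F] [Module ℂ F] [TopologicalSpace F] [IsTopologicalAddGroup F]
  [ContinuousSMul ℂ F]
  {f : E → F} {U : Set E} {x : E}

/-- The iterated directional derivatives `(x, v) ↦ D_{v₀} ⋯ D_{vₙ₋₁} f (x)`. -/
noncomputable def iterDirDeriv (f : E → F) : (n : ℕ) → E × (Fin n → E) → F
  | 0, z => f z.1
  | n + 1, z => limUnder (𝓝[≠] (0 : ℂ)) fun t : ℂ =>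
      t⁻¹ • (iterDirDeriv f n (z.1 + t • z.2 0, Fin.tail z.2) - iterDirDeriv f n (z.1, Fin.tail z.2))

/-- Each further iterated derivative is the full differential of the previous one, precomposed with
the linear map `(x, v) ↦ ((x, tail v), (v 0, 0))`. So every order of smoothness is inherited, and
the limit in `iterDirDeriv` exists. -/
theorem ckGen_iterDirDeriv_and [T2Space F] (hU : IsOpen U) (h : ∀ k, CkGen ℂ k f U) (n : ℕ) :
    (∀ k, CkGen ℂ k (iterDirDeriv f n) (U ×ˢ univ)) ∧ ∀ x ∈ U, ∀ v : Fin (n + 1) → E,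
      HasDirDeriv ℂ (fun y => iterDirDeriv f n (y, Fin.tail v)) x (v 0)
        (iterDirDeriv f (n + 1) (x, v)) := by
  have step : ∀ n, (∀ k, CkGen ℂ k (iterDirDeriv f n) (U ×ˢ univ)) → ∀ k,
      ∃ d : (E × (Fin n → E)) × (E × (Fin n → E)) → F,
        CkGen ℂ k d ((U ×ˢ univ) ×ˢ univ) ∧ ∀ x ∈ U, ∀ v : Fin (n + 1) → E,
          HasDirDeriv ℂ (fun y => iterDirDeriv f n (y, Fin.tail v)) x (v 0)
            (d ((x, Fin.tail v), (v 0, 0))) ∧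
          iterDirDeriv f (n + 1) (x, v) = d ((x, Fin.tail v), (v 0, 0)) := by
    intro n hn k
    obtain ⟨d, h1, h2⟩ := (hn (k + 1)).exists_hasContDirDeriv
    have key : ∀ x ∈ U, ∀ v : Fin (n + 1) → E,
        HasDirDeriv ℂ (fun y => iterDirDeriv f n (y, Fin.tail v)) x (v 0)
          (d ((x, Fin.tail v), (v 0, 0))) := by
      intro x hx v
      refine Tendsto.congr (fun t => ?_) (h1.hasDirDeriv (x, Fin.tail v) ⟨hx, trivial⟩ (v 0, 0))
      simp
    exact ⟨d, h2, fun x hx v => ⟨key x hx v, (key x hx v).limUnder_eq⟩⟩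
  have main : ∀ k, CkGen ℂ k (iterDirDeriv f n) (U ×ˢ univ) := by
    induction n with
    | zero => exact fun k => (h k).comp_clm (ContinuousLinearMap.fst ℂ E (Fin 0 → E)) fun z hz => hz.1
    | succ n ih =>
      intro k
      obtain ⟨d, h1, h2⟩ := step n ih k
      let A : E × (Fin (n + 1) → E) →L[ℂ] (E × (Fin n → E)) × (E × (Fin n → E)) :=
        ((ContinuousLinearMap.fst ℂ E (Fin (n + 1) → E)).prod
          ((ContinuousLinearMap.pi fun i => ContinuousLinearMap.proj (i.succ)).comp
            (ContinuousLinearMap.snd ℂ E (Fin (n + 1) → E)))).prod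
        (((ContinuousLinearMap.proj 0).comp (ContinuousLinearMap.snd ℂ E (Fin (n + 1) → E))).prod 0)
      refine (h1.comp_clm A fun z hz => ⟨⟨hz.1, trivial⟩, trivial⟩).congr (hU.prod isOpen_univ) ?_
      rintro ⟨x, v⟩ ⟨hx, -⟩
      exact (h2 x hx v).2.symm
  refine ⟨main, fun x hx v => ?_⟩
  obtain ⟨d, -, h2⟩ := step n main 0
  rw [(h2 x hx v).2]
  exact (h2 x hx v).1

theorem hasDirDeriv_iterDirDeriv [T2Space F] (hU : IsOpen U) (h : ∀ k, CkGen ℂ k f U) {n : ℕ}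
    (hx : x ∈ U) (v : Fin (n + 1) → E) :
    HasDirDeriv ℂ (fun y => iterDirDeriv f n (y, Fin.tail v)) x (v 0)
      (iterDirDeriv f (n + 1) (x, v)) := (ckGen_iterDirDeriv_and hU h n).2 x hx v

theorem hasContDirDeriv_iterDirDeriv [T2Space F] (hU : IsOpen U) (h : ∀ k, CkGen ℂ k f U) {n : ℕ}
    (w : Fin n → E) :
    HasContDirDeriv ℂ (fun y => iterDirDeriv f n (y, w))
      (fun z => iterDirDeriv f (n + 1) (z.1, Fin.cons z.2 w)) U := by
  refine ⟨fun x hx v => ?_, ?_⟩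
  · simpa using hasDirDeriv_iterDirDeriv hU h hx (Fin.cons v w : Fin (n + 1) → E)
  · refine ((ckGen_iterDirDeriv_and hU h (n + 1)).1 0).continuousOn.comp
      (Continuous.continuousOn ?_) fun z hz => ⟨hz.1, trivial⟩
    exact continuous_fst.prodMk (Continuous.finCons continuous_snd continuous_const)

/-- In slot `0` this is additivity of a first derivative; in a later slot it is the identity for
`n`, differentiated in `x`. Symmetry of higher derivatives is not needed. -/
theorem iterDirDeriv_update_add [PolynormableSpace ℂ F] [T2Space F] (hU : IsOpen U)
    (h : ∀ k, CkGen ℂ k f U) {n : ℕ} (v : Fin n → E) (i : Fin n) (a b : E) (hx : x ∈ U) :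
    iterDirDeriv f n (x, Function.update v i (a + b)) =
      iterDirDeriv f n (x, Function.update v i a) + iterDirDeriv f n (x, Function.update v i b) := by
  induction n generalizing x with
  | zero => exact i.elim0
  | succ n ih =>
    cases i using Fin.cases with
    | zero =>
      rw [← Fin.cons_self_tail v]
      simp only [Fin.update_cons_zero]
      exact (hasContDirDeriv_iterDirDeriv hU h (Fin.tail v)).map_add hU hx a b
    | succ i =>
      have h1 := fun c => hasDirDeriv_iterDirDeriv hU h hx (Function.update v i.succ c)
      simp only [Fin.tail_update_succ, Function.update_of_ne (Fin.succ_ne_zero i).symm] at h1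
      refine (h1 (a + b)).unique ?_
      refine HasDirDeriv.congr_of_eqOn (f := fun y =>
        iterDirDeriv f n (y, Function.update (Fin.tail v) i a) +
        iterDirDeriv f n (y, Function.update (Fin.tail v) i b)) hU hx ?_ fun y hy => (ih _ _ hy).symm
      refine Tendsto.congr (fun t => ?_) ((h1 a).add (h1 b))
      rw [← smul_add]
      exact congrArg _ (sub_add_sub_comm _ _ _ _)

theorem iterDirDeriv_update_smul [PolynormableSpace ℂ F] [T2Space F] (hU : IsOpen U)
    (h : ∀ k, CkGen ℂ k f U) {n : ℕ} (v : Fin n → E) (i : Fin n) (c : ℂ) (a : E) (hx : x ∈ U) :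
    iterDirDeriv f n (x, Function.update v i (c • a)) =
      c • iterDirDeriv f n (x, Function.update v i a) := by
  induction n generalizing x with
  | zero => exact i.elim0
  | succ n ih =>
    cases i using Fin.cases with
    | zero =>
      rw [← Fin.cons_self_tail v]
      simp only [Fin.update_cons_zero]
      have h1 := (hasContDirDeriv_iterDirDeriv hU h (Fin.tail v)).hasDirDeriv x hx
      exact (h1 a).map_smul (h1 (c • a))
    | succ i =>
      have h1 := fun c => hasDirDeriv_iterDirDeriv hU h hx (Function.update v i.succ c)
      simp only [Fin.tail_update_succ, Function.update_of_ne (Fin.succ_ne_zero i).symm] at h1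
      refine (h1 (c • a)).unique ?_
      refine HasDirDeriv.congr_of_eqOn (f := fun y =>
        c • iterDirDeriv f n (y, Function.update (Fin.tail v) i a)) hU hx ?_
          fun y hy => (ih _ _ hy).symm
      refine Tendsto.congr (fun t => ?_) ((h1 a).const_smul c)
      rw [← smul_sub, smul_comm]

/-- The Taylor coefficients of a smooth map over `ℂ`. -/
noncomputable def taylorCoeff [PolynormableSpace ℂ F] [T2Space F] (hU : IsOpen U)
    (h : ∀ k, CkGen ℂ k f U) (hx : x ∈ U) (n : ℕ) :
    ContinuousMultilinearMap ℂ (fun _ : Fin n => E) F where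
  toFun v := (n.factorial : ℂ)⁻¹ • iterDirDeriv f n (x, v)
  map_update_add' v i a b := by
    have h' : ‹DecidableEq (Fin n)› = instDecidableEqFin n := Subsingleton.elim _ _
    subst h'
    rw [iterDirDeriv_update_add hU h v i a b hx, smul_add]
  map_update_smul' v i c a := by
    have h' : ‹DecidableEq (Fin n)› = instDecidableEqFin n := Subsingleton.elim _ _
    subst h'
    rw [iterDirDeriv_update_smul hU h v i c a hx, smul_comm]
  cont := by
    refine Continuous.const_smul ?_ _
    exact continuousOn_univ.1 (((ckGen_iterDirDeriv_and hU h n).1 0).continuousOn.comp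
      (Continuous.continuousOn (by fun_prop)) fun v _ => ⟨hx, trivial⟩)

theorem taylorCoeff_apply [PolynormableSpace ℂ F] [T2Space F] (hU : IsOpen U)
    (h : ∀ k, CkGen ℂ k f U) (hx : x ∈ U) (n : ℕ) (v : Fin n → E) :
    taylorCoeff hU h hx n v = (n.factorial : ℂ)⁻¹ • iterDirDeriv f n (x, v) := rfl

theorem iteratedDeriv_line [T2Space F] (hU : IsOpen U) (h : ∀ k, CkGen ℂ k f U) {B : Type*}
    [NormedAddCommGroup B] [NormedSpace ℂ B] (q : F →L[ℂ] B) {O : Set ℂ} (hO : IsOpen O) {y : E}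
    (hy : ∀ z ∈ O, x + z • y ∈ U) (n : ℕ) {z : ℂ} (hz : z ∈ O) :
    iteratedDeriv n (fun z => q (f (x + z • y))) z = q (iterDirDeriv f n (x + z • y, fun _ => y)) := by
  induction n generalizing z with
  | zero => simp [iterDirDeriv]
  | succ n ih =>
    rw [iteratedDeriv_succ]
    have h1 := (hasDirDeriv_iterDirDeriv hU h (hy z hz) (fun _ : Fin (n + 1) => y)).hasDerivAt q
    refine (h1.congr_of_eventuallyEq ?_).deriv
    filter_upwards [hO.mem_nhds hz] with s hs using ih hs

/-- A map which is smooth over `ℂ` is complex analytic. -/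
theorem complexAnalyticOn_of_ckGen [PolynormableSpace ℂ F] [T2Space F] (hU : IsOpen U)
    (h : ∀ k, CkGen ℂ k f U) : ComplexAnalyticOn f U := by
  refine ⟨(h 0).continuousOn, fun x hx => ⟨taylorCoeff hU h hx,
    {y | ∀ ζ ∈ Metric.closedBall (0 : ℂ) 2, x + ζ • y ∈ U}, ?_, fun y hy => ⟨?_, ?_⟩⟩⟩
  · refine (isCompact_closedBall (0 : ℂ) 2).eventually_forall_of_forall_eventually fun ζ _ => ?_
    exact (Continuous.tendsto' (f := fun z : E × ℂ => x + z.2 • z.1) (by fun_prop) (0, ζ) x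
      (by simp)).eventually (hU.mem_nhds hx)
  · simpa using hy 1 (by simp)
  · refine tendsto_of_forall_banach (𝕜 := ℂ) fun B _ _ _ q => ?_
    have hy' : ∀ z ∈ Metric.ball (0 : ℂ) 2, x + z • y ∈ U := fun z hz =>
      hy z (Metric.ball_subset_closedBall hz)
    have hdiff : DifferentiableOn ℂ (fun z : ℂ => q (f (x + z • y))) (Metric.ball 0 2) := by
      intro z hz
      obtain ⟨df, hdf, -⟩ := (h 1).exists_hasContDirDeriv
      exact ((hdf.hasDirDeriv _ (hy' z hz) y).hasDerivAt q).differentiableAt.differentiableWithinAt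
    -- The disc of radius `2` contains `z = 1` in its interior, and there the line reaches `x + y`.
    have h1 := (Complex.hasSum_taylorSeries_on_ball hdiff
      (show (1 : ℂ) ∈ Metric.ball (0 : ℂ) 2 by simp)).tendsto_sum_nat
    simp only [one_smul] at h1
    refine h1.congr fun m => ?_
    rw [map_sum]
    refine Finset.sum_congr rfl fun n _ => ?_
    rw [iteratedDeriv_line hU h q Metric.isOpen_ball hy' n (Metric.mem_ball_self two_pos)]
    simp [taylorCoeff_apply]

end Taylor

end LocallyConvexCalculus

/-! ### Complexifications and complex functionals -/

namespace Complexification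

variable {E : Type u} [AddCommGroup E] [Module ℝ E] [TopologicalSpace E]

instance [IsTopologicalAddGroup E] : IsTopologicalAddGroup (Complexification E) :=
  inferInstanceAs (IsTopologicalAddGroup (E × E))

instance [T2Space E] : T2Space (Complexification E) := inferInstanceAs (T2Space (E × E))

theorem continuous_re : Continuous fun w : Complexification E => w.1 :=
  continuous_fst (X := E) (Y := E)

theorem continuous_im : Continuous fun w : Complexification E => w.2 :=
  continuous_snd (X := E) (Y := E)

theorem continuous_mk {X : Type*} [TopologicalSpace X] {a b : X → E} (ha : Continuous a)
    (hb : Continuous b) : Continuous fun x => ((a x, b x) : Complexification E) :=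
  ha.prodMk hb

theorem continuous_ofReal : Continuous (ofReal : E → Complexification E) :=
  continuous_mk continuous_id continuous_const

instance [IsTopologicalAddGroup E] [ContinuousSMul ℝ E] :
    ContinuousSMul ℂ (Complexification E) where
  continuous_smul := by
    have h1 : Continuous fun p : ℂ × Complexification E => p.2.1 :=
      continuous_re.comp continuous_snd
    have h2 : Continuous fun p : ℂ × Complexification E => p.2.2 :=
      continuous_im.comp continuous_snd
    have h3 : Continuous fun p : ℂ × Complexification E => p.1.re :=
      Complex.continuous_re.comp continuous_fst
    have h4 : Continuous fun p : ℂ × Complexification E => p.1.im :=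
      Complex.continuous_im.comp continuous_fst
    exact continuous_mk ((h3.smul h1).sub (h4.smul h2)) ((h3.smul h2).add (h4.smul h1))

theorem real_smul_fst (r : ℝ) (w : Complexification E) : (r • w).1 = r • w.1 := by
  rw [← Complex.coe_smul, smul_fst]
  simp

theorem real_smul_snd (r : ℝ) (w : Complexification E) : (r • w).2 = r • w.2 := by
  rw [← Complex.coe_smul, smul_snd]
  simp

instance [IsTopologicalAddGroup E] [ContinuousSMul ℝ E] [PolynormableSpace ℝ E] :
    LocallyConvexSpace ℝ (Complexification E) := by
  let e : Complexification E →ₗ[ℝ] E × E :=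
    { toFun := fun w => (w.1, w.2)
      map_add' := fun _ _ => rfl
      map_smul' := fun r w => by rw [real_smul_fst, real_smul_snd]; rfl }
  have : LocallyConvexSpace ℝ E := (PolynormableSpace.withSeminorms ℝ E).toLocallyConvexSpace
  have : LocallyConvexSpace ℝ (E × E) := Prod.locallyConvexSpace
  exact (show IsInducing e from IsInducing.id).locallyConvexSpace

end Complexification

open scoped ComplexOrder in
/-- A complex vector space which is locally convex over `ℝ` is polynormable. -/
theorem polynormableSpace_complex {E : Type u} [AddCommGroup E] [Module ℂ E] [TopologicalSpace E]
    [IsTopologicalAddGroup E] [ContinuousSMul ℂ E] [LocallyConvexSpace ℝ E] :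
    PolynormableSpace ℂ E := by
  have : ContinuousSMul ℝ E := IsScalarTower.continuousSMul (M := ℝ) (α := E) ℂ
  -- The nonnegative elements of `ℂ` are the nonnegative reals, so convexity means the same over
  -- both fields.
  have : LocallyConvexSpace ℂ E := by
    refine ⟨fun x => (LocallyConvexSpace.convex_basis (𝕜 := ℝ) x).congr (fun s => ?_) fun _ _ => rfl⟩
    refine and_congr_right fun _ => ⟨fun h => ?_, fun h => h.lift ℝ⟩
    exact convex_of_nonneg_surjective_algebraMap _
        (fun _ hz => RCLike.nonneg_iff_exists_ofReal.mp hz) h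
  infer_instance

namespace Complexification

variable {E : Type u} [AddCommGroup E] [Module ℝ E] [TopologicalSpace E]
  {F : Type v} [AddCommGroup F] [Module ℝ F] [TopologicalSpace F]

instance [IsTopologicalAddGroup E] [ContinuousSMul ℝ E] [PolynormableSpace ℝ E] :
    PolynormableSpace ℂ (Complexification E) := polynormableSpace_complex

theorem ofReal_fst (x : E) : (ofReal x).1 = x := rfl

theorem ofReal_snd (x : E) : (ofReal x).2 = 0 := rfl

theorem ofReal_add_smul (x v : E) (t : ℝ) :
    ofReal (x + t • v) = ofReal x + (t : ℂ) • ofReal v := by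
  apply ext' <;> simp [ofReal_fst, ofReal_snd, add_fst, add_snd, real_smul_fst, real_smul_snd]

theorem eq_ofReal_add (w : Complexification E) :
    w = ofReal w.1 + Complex.I • ofReal w.2 := by
  apply ext' <;> simp [ofReal_fst, ofReal_snd, add_fst, add_snd, smul_fst, smul_snd]

/-- The complexification of a continuous linear map. -/
def mapCLM (A : E →L[ℝ] F) : Complexification E →L[ℂ] Complexification F where
  toFun w := (A w.1, A w.2)
  map_add' a b := ext' (map_add A a.1 b.1) (map_add A a.2 b.2)
  map_smul' z a := by
    apply ext'
    · exact (map_sub A _ _).trans (congrArg₂ _ (map_smul A _ _) (map_smul A _ _))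
    · exact (map_add A _ _).trans (congrArg₂ _ (map_smul A _ _) (map_smul A _ _))
  cont := continuous_mk (A.continuous.comp continuous_re) (A.continuous.comp continuous_im)

theorem mapCLM_ofReal (A : E →L[ℝ] F) (x : E) : mapCLM A (ofReal x) = ofReal (A x) := 
  ext' rfl (map_zero A)

theorem isClosedEmbedding_mapCLM {A : E →L[ℝ] F} (hA : IsClosedEmbedding A) :
    IsClosedEmbedding (mapCLM A) :=
  hA.prodMap hA

end Complexification

namespace LocallyConvexCalculus

/-- A closed complex subspace is the intersection of the kernels of the continuous linear
functionals which vanish on it. -/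
theorem mem_of_forall_strongDual {F : Type v} [AddCommGroup F] [Module ℂ F] [TopologicalSpace F]
    [IsTopologicalAddGroup F] [ContinuousSMul ℂ F] [LocallyConvexSpace ℝ F] {Y : Submodule ℂ F}
    (hY : IsClosed (Y : Set F)) {y : F}
    (h : ∀ q : F →L[ℂ] ℂ, (∀ z ∈ Y, q z = 0) → q y = 0) : y ∈ Y := by
  by_contra hy
  obtain ⟨q, s, hs, hsy⟩ := RCLike.geometric_hahn_banach_closed_point (𝕜 := ℂ) (x := y)
    (Y.restrictScalars ℝ).convex hY hy
  have hs0 : 0 < s := by simpa using hs 0 Y.zero_mem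
  have h0 : ∀ z ∈ Y, q z = 0 := by
    intro z hz
    by_contra hqz
    -- Rescaled so that `q` takes the value `s`, the vector violates the strict bound on `Y`.
    have h1 := hs _ (Y.smul_mem ((s : ℂ) * (q z)⁻¹) hz)
    simp [hqz] at h1
  rw [h q h0] at hsy
  simp only [map_zero] at hsy
  exact lt_asymm hs0 hsy

end LocallyConvexCalculus

/-! ### Closure properties of complex and real analytic maps -/

namespace LocallyConvexCalculus

open Complexification

section Complex

variable
  {E : Type u} [AddCommGroup E] [Module ℂ E] [TopologicalSpace E] [IsTopologicalAddGroup E]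
  [ContinuousSMul ℂ E]
  {F : Type v} [AddCommGroup F] [Module ℂ F] [TopologicalSpace F] [IsTopologicalAddGroup F]
  [ContinuousSMul ℂ F] [PolynormableSpace ℂ F] [T2Space F]
  {f g : E → F} {U V : Set E}

/-- This and the following closure properties are transferred from `CkGen` of all orders; for
composition this avoids substituting one series into another. -/
theorem _root_.ComplexAnalyticOn.mono (h : ComplexAnalyticOn f U) (hU : IsOpen U) (hV : IsOpen V)
    (hVU : V ⊆ U) : ComplexAnalyticOn f V :=
  complexAnalyticOn_of_ckGen hV fun k => (h.ckGen hU k).mono hVU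

theorem _root_.ComplexAnalyticOn.congr (h : ComplexAnalyticOn f U) (hU : IsOpen U)
    (hfg : EqOn f g U) : ComplexAnalyticOn g U :=
  complexAnalyticOn_of_ckGen hU fun k => (h.ckGen hU k).congr hU hfg

theorem _root_.ComplexAnalyticOn.of_local (hU : IsOpen U)
    (h : ∀ x ∈ U, ∃ V, IsOpen V ∧ x ∈ V ∧ ComplexAnalyticOn f V) : ComplexAnalyticOn f U := by
  refine complexAnalyticOn_of_ckGen hU fun k => CkGen.of_local hU fun x hx => ?_
  obtain ⟨V, hV, hxV, hf⟩ := h x hx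
  exact ⟨V, hV, hxV, hf.ckGen hV k⟩

theorem _root_.ComplexAnalyticOn.clm (A : E →L[ℂ] F) (hU : IsOpen U) : ComplexAnalyticOn A U :=
  complexAnalyticOn_of_ckGen hU fun _ => CkGen.clm A

theorem _root_.ComplexAnalyticOn.add (hf : ComplexAnalyticOn f U) (hg : ComplexAnalyticOn g U)
    (hU : IsOpen U) : ComplexAnalyticOn (fun x => f x + g x) U :=
  complexAnalyticOn_of_ckGen hU fun k => (hf.ckGen hU k).add (hg.ckGen hU k)

theorem _root_.ComplexAnalyticOn.comp {G : Type w} [AddCommGroup G] [Module ℂ G]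
    [TopologicalSpace G] [IsTopologicalAddGroup G] [ContinuousSMul ℂ G] [PolynormableSpace ℂ G]
    [T2Space G] {g : F → G} {V : Set F} (hg : ComplexAnalyticOn g V) (hf : ComplexAnalyticOn f U)
    (hU : IsOpen U) (hV : IsOpen V) (hfV : MapsTo f U V) :
    ComplexAnalyticOn (fun x => g (f x)) U :=
  complexAnalyticOn_of_ckGen hU fun k => (hg.ckGen hV k).comp (hf.ckGen hU k) hV hfV

theorem _root_.ComplexAnalyticOn.of_comp_isClosedEmbedding {G : Type w} [AddCommGroup G] [Module ℂ G]
    [TopologicalSpace G] [IsTopologicalAddGroup G] [ContinuousSMul ℂ G] [PolynormableSpace ℂ G]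
    [T2Space G] (J : F →L[ℂ] G) (hJ : IsClosedEmbedding J) (hU : IsOpen U)
    (h : ComplexAnalyticOn (fun x => J (f x)) U) : ComplexAnalyticOn f U :=
  complexAnalyticOn_of_ckGen hU fun k => CkGen.of_comp_isClosedEmbedding J hJ hU (h.ckGen hU k)

end Complex

section Real

variable
  {E : Type u} [AddCommGroup E] [Module ℝ E] [TopologicalSpace E] [IsTopologicalAddGroup E]
  [ContinuousSMul ℝ E]

/-- The points `a + ib` with `a ∈ U` such that `a + zb ∈ W` for all complex numbers `z` with
`|z| ≤ 2`. -/
def complexTube (U : Set E) (W : Set (Complexification E)) : Set (Complexification E) :=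
  {w | w.1 ∈ U ∧ ∀ z ∈ Metric.closedBall (0 : ℂ) 2, ofReal w.1 + z • ofReal w.2 ∈ W}

theorem isOpen_complexTube {U : Set E} {W : Set (Complexification E)} (hU : IsOpen U)
    (hW : IsOpen W) : IsOpen (complexTube U W) := by
  refine (hU.preimage Complexification.continuous_re).inter (isOpen_iff_eventually.2 fun w hw => ?_)
  refine (isCompact_closedBall (0 : ℂ) 2).eventually_forall_of_forall_eventually fun z hz => ?_
  have h1 : Continuous fun p : Complexification E × ℂ => ofReal p.1.1 + p.2 • ofReal p.1.2 :=
    (continuous_ofReal.comp (Complexification.continuous_re.comp continuous_fst)).add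
      (continuous_snd.smul
        (continuous_ofReal.comp (Complexification.continuous_im.comp continuous_fst)))
  exact (h1.tendsto (w, z)).eventually (hW.mem_nhds (hw z hz))

theorem ofReal_mem_complexTube {U : Set E} {W : Set (Complexification E)} {x : E} (hx : x ∈ U)
    (hW : ofReal x ∈ W) : ofReal x ∈ complexTube U W := by
  refine ⟨hx, fun z _ => ?_⟩
  have : ofReal (ofReal x).2 = 0 := rfl
  rw [this, smul_zero, add_zero]
  exact hW

theorem complexTube_subset {U : Set E} {W : Set (Complexification E)} : complexTube U W ⊆ W := by
  intro w hw
  rw [eq_ofReal_add w]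
  exact hw.2 Complex.I (by simp)

theorem tendsto_ofReal_punctured : Tendsto (fun t : ℝ => (t : ℂ)) (𝓝[≠] 0) (𝓝[≠] 0) := by
  refine tendsto_nhdsWithin_iff.2 ⟨?_, ?_⟩
  · exact (Complex.continuous_ofReal.tendsto' 0 0 (by simp)).mono_left nhdsWithin_le_nhds
  · filter_upwards [self_mem_nhdsWithin] with t ht
    have ht' : t ≠ 0 := ht
    simpa using ht'

/-- Identity theorem: complex analytic maps which agree at real points agree on a neighbourhood. -/
theorem eq_of_eq_on_real {B : Type*} [NormedAddCommGroup B] [NormedSpace ℂ B] [CompleteSpace B]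
    {G : Type v} [AddCommGroup G] [Module ℂ G] [TopologicalSpace G] [IsTopologicalAddGroup G]
    [ContinuousSMul ℂ G] [PolynormableSpace ℂ G] [T2Space G]
    {U : Set E} (hU : IsOpen U) {W₁ W₂ : Set (Complexification E)} (hW₁ : IsOpen W₁)
    (hW₂ : IsOpen W₂) {g₁ g₂ : Complexification E → G} (h₁ : ComplexAnalyticOn g₁ W₁)
    (h₂ : ComplexAnalyticOn g₂ W₂) (q₁ q₂ : G →L[ℂ] B)
    (h : ∀ x ∈ U, q₁ (g₁ (ofReal x)) = q₂ (g₂ (ofReal x))) {w : Complexification E} (hwU : w.1 ∈ U)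
    (hw₁ : ∀ z ∈ Metric.closedBall (0 : ℂ) 2, ofReal w.1 + z • ofReal w.2 ∈ W₁)
    (hw₂ : ∀ z ∈ Metric.closedBall (0 : ℂ) 2, ofReal w.1 + z • ofReal w.2 ∈ W₂) :
    q₁ (g₁ w) = q₂ (g₂ w) := by
  have key : ∀ {g : Complexification E → G} {W : Set (Complexification E)} (q : G →L[ℂ] B),
      IsOpen W → ComplexAnalyticOn g W →
      (∀ z ∈ Metric.closedBall (0 : ℂ) 2, ofReal w.1 + z • ofReal w.2 ∈ W) →
      AnalyticOnNhd ℂ (fun z : ℂ => q (g (ofReal w.1 + z • ofReal w.2))) (Metric.ball 0 2) := by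
    intro g W q hW hg hw
    obtain ⟨dg, hdg, -⟩ := (hg.ckGen hW 1).exists_hasContDirDeriv
    refine DifferentiableOn.analyticOnNhd (fun z hz => ?_) Metric.isOpen_ball
    exact ((hdg.hasDirDeriv _ (hw z (Metric.ball_subset_closedBall hz)) _).hasDerivAt
      q).differentiableAt.differentiableWithinAt
  -- On the complex line through `w` the two functions agree at small real `z`, which accumulate at
  -- `0`. The one-variable identity theorem on the disc of radius `2` carries this to `z = I`, which
  -- is `w` itself.
  have h3 : ∃ᶠ z : ℂ in 𝓝[≠] 0, q₁ (g₁ (ofReal w.1 + z • ofReal w.2)) =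
      q₂ (g₂ (ofReal w.1 + z • ofReal w.2)) := by
    refine tendsto_ofReal_punctured.frequently (Eventually.frequently ?_)
    filter_upwards [nhdsWithin_le_nhds (eventually_add_smul_mem (𝕜 := ℝ) hU hwU w.2)] with t ht
    rw [← ofReal_add_smul]
    exact h _ ht
  have h4 := (key q₁ hW₁ h₁ hw₁).eqOn_of_preconnected_of_frequently_eq (key q₂ hW₂ h₂ hw₂)
    (convex_ball _ _).isPreconnected (Metric.mem_ball_self two_pos) h3
    (show Complex.I ∈ Metric.ball (0 : ℂ) 2 by simp)
  simpa only [← eq_ofReal_add w] using h4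

variable
  {F : Type v} [AddCommGroup F] [Module ℝ F] [TopologicalSpace F] [IsTopologicalAddGroup F]
  [ContinuousSMul ℝ F]
  {f g : E → F} {U V : Set E}

theorem _root_.RealAnalyticOn.mono (h : RealAnalyticOn f U) (hVU : V ⊆ U) : RealAnalyticOn f V := by
  obtain ⟨W, g, hW, hUW, hg, hgf⟩ := h
  exact ⟨W, g, hW, fun x hx => hUW x (hVU hx), hg, fun x hx => hgf x (hVU hx)⟩

theorem _root_.RealAnalyticOn.congr (h : RealAnalyticOn f U) (hfg : EqOn f g U) :
    RealAnalyticOn g U := by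
  obtain ⟨W, e, hW, hUW, he, hef⟩ := h
  exact ⟨W, e, hW, hUW, he, fun x hx => by rw [hef x hx, hfg hx]⟩

variable [PolynormableSpace ℝ F] [T2Space F]

theorem _root_.RealAnalyticOn.clm (A : E →L[ℝ] F) : RealAnalyticOn A U :=
  ⟨univ, mapCLM A, isOpen_univ, fun _ _ => trivial, ComplexAnalyticOn.clm _ isOpen_univ,
    fun x _ => mapCLM_ofReal A x⟩

theorem _root_.RealAnalyticOn.add (hf : RealAnalyticOn f U) (hg : RealAnalyticOn g U) :
    RealAnalyticOn (fun x => f x + g x) U := by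
  obtain ⟨W₁, e₁, hW₁, hUW₁, he₁, hef₁⟩ := hf
  obtain ⟨W₂, e₂, hW₂, hUW₂, he₂, hef₂⟩ := hg
  have hW := hW₁.inter hW₂
  refine ⟨W₁ ∩ W₂, fun w => e₁ w + e₂ w, hW, fun x hx => ⟨hUW₁ x hx, hUW₂ x hx⟩,
    (he₁.mono hW₁ hW inter_subset_left).add (he₂.mono hW₂ hW inter_subset_right) hW,
    fun x hx => ?_⟩
  simp only [hef₁ x hx, hef₂ x hx]
  exact Complexification.ext' rfl (add_zero _)

theorem _root_.RealAnalyticOn.comp {G : Type w} [AddCommGroup G] [Module ℝ G]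
    [TopologicalSpace G] [IsTopologicalAddGroup G] [ContinuousSMul ℝ G] [PolynormableSpace ℝ G]
    [T2Space G] {g : F → G} {V : Set F} (hg : RealAnalyticOn g V) (hf : RealAnalyticOn f U)
    (hfV : MapsTo f U V) : RealAnalyticOn (fun x => g (f x)) U := by
  obtain ⟨W₁, e₁, hW₁, hUW₁, he₁, hef₁⟩ := hf
  obtain ⟨W₂, e₂, hW₂, hUW₂, he₂, hef₂⟩ := hg
  have hW : IsOpen (W₁ ∩ e₁ ⁻¹' W₂) := he₁.1.isOpen_inter_preimage hW₁ hW₂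
  refine ⟨W₁ ∩ e₁ ⁻¹' W₂, fun w => e₂ (e₁ w), hW, fun x hx => ⟨hUW₁ x hx, ?_⟩,
    he₂.comp (he₁.mono hW₁ hW inter_subset_left) hW hW₂ fun w hw => hw.2, fun x hx => ?_⟩
  · rw [mem_preimage, hef₁ x hx]
    exact hUW₂ _ (hfV hx)
  · simp only [hef₁ x hx, hef₂ _ (hfV hx)]

/-- First order suffices: it provides Hadamard derivatives, while the closure properties of real
analytic maps come from their extensions. The derivative is the real part of that of the extension.
-/
theorem _root_.RealAnalyticOn.ckGen_one (h : RealAnalyticOn f U) (hU : IsOpen U) :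
    CkGen ℝ 1 f U := by
  obtain ⟨W, g, hW, hUW, hg, hgf⟩ := h
  obtain ⟨dg, hdg, -⟩ := (hg.ckGen hW 1).exists_hasContDirDeriv
  have hd : ContinuousOn (fun z : E × E => (dg (ofReal z.1, ofReal z.2)).1) (U ×ˢ univ) := by
    refine Complexification.continuous_re.comp_continuousOn (hdg.continuousOn.comp ?_
      fun z hz => ⟨hUW _ hz.1, trivial⟩)
    exact ((continuous_ofReal.comp continuous_fst).prodMk
      (continuous_ofReal.comp continuous_snd)).continuousOn
  have hf : ContinuousOn f U := by
    refine ContinuousOn.congr (f := fun x => (g (ofReal x)).1)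
      (Complexification.continuous_re.comp_continuousOn
        (hg.1.comp continuous_ofReal.continuousOn hUW)) fun x hx => ?_
    exact congrArg Prod.fst (hgf x hx).symm
  refine ⟨hf, _, fun x hx v => ?_, hd⟩
  have h1 := (Complexification.continuous_re.tendsto _).comp
    ((hdg.hasDirDeriv _ (hUW x hx) (ofReal v)).comp tendsto_ofReal_punctured)
  refine Tendsto.congr' ?_ h1
  filter_upwards [nhdsWithin_le_nhds (eventually_add_smul_mem (𝕜 := ℝ) hU hx v)] with t ht
  simp only [Function.comp_apply]
  rw [← ofReal_add_smul, hgf _ ht, hgf _ hx, ← Complex.ofReal_inv, Complex.coe_smul, real_smul_fst]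
  simp only [sub_eq_add_neg]
  rfl

/-- Real analyticity is a local property. -/
theorem _root_.RealAnalyticOn.of_local (h : ∀ x ∈ U, ∃ V, IsOpen V ∧ x ∈ V ∧ RealAnalyticOn f V) :
    RealAnalyticOn f U := by
  classical
  choose! V hV hxV W g hW hVW hg hgf using h
  set T : E → Set (Complexification E) := fun x => complexTube (V x) (W x) with hT
  have hTo : ∀ x ∈ U, IsOpen (T x) := fun x hx => isOpen_complexTube (hV x hx) (hW x hx)
  -- The intersection of the domains `W x` and `W y` may have components without real points. A
  -- point of both tubes is joined to its real part by a disc inside both domains, so the identity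
  -- theorem applies.
  have huniq : ∀ x ∈ U, ∀ y ∈ U, ∀ w, w ∈ T x → w ∈ T y → g x w = g y w := by
    intro x hx y hy w hwx hwy
    -- Equality is phrased as convergence of a constant sequence, so that it can be tested by maps
    -- to Banach spaces.
    refine tendsto_nhds_unique (f := fun _ : ℕ => g x w) (l := atTop) tendsto_const_nhds
      (tendsto_of_forall_banach (𝕜 := ℂ) fun B _ _ _ q => ?_)
    rw [eq_of_eq_on_real ((hV x hx).inter (hV y hy)) (hW x hx) (hW y hy) (hg x hx) (hg y hy) q q
      (fun z hz => by rw [hgf x hx z hz.1, hgf y hy z hz.2]) ⟨hwx.1, hwy.1⟩ hwx.2 hwy.2]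
    exact tendsto_const_nhds
  let G : Complexification E → Complexification F := fun w =>
    if h : ∃ x ∈ U, w ∈ T x then g h.choose w else 0
  have hG : ∀ x ∈ U, EqOn (g x) G (T x) := by
    intro x hx w hw
    have h : ∃ x ∈ U, w ∈ T x := ⟨x, hx, hw⟩
    simp only [G, dif_pos h]
    exact huniq x hx _ h.choose_spec.1 w hw h.choose_spec.2
  have hO : IsOpen (⋃ x ∈ U, T x) := isOpen_biUnion hTo
  have hself : ∀ x ∈ U, ofReal x ∈ T x := fun x hx =>
    ofReal_mem_complexTube (hxV x hx) (hVW x hx x (hxV x hx))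
  refine ⟨⋃ x ∈ U, T x, G, hO, fun x hx => mem_biUnion hx (hself x hx),
    ComplexAnalyticOn.of_local hO fun w hw => ?_, fun x hx => ?_⟩
  · obtain ⟨x, hx, hwx⟩ := mem_iUnion₂.1 hw
    exact ⟨T x, hTo x hx, hwx, ((hg x hx).mono (hW x hx) (hTo x hx) complexTube_subset).congr
      (hTo x hx) (hG x hx)⟩
  · rw [← hG x hx (hself x hx), hgf x hx x (hxV x hx)]

/-- Away from real points an extension `g` of `J ∘ f` might leave the complexified range of `J`. A
functional vanishing on that range kills `g` at real points, hence on the tube by the identity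
theorem; Hahn–Banach then puts `g` into the closed range. -/
theorem _root_.RealAnalyticOn.of_comp_isClosedEmbedding {G : Type w} [AddCommGroup G] [Module ℝ G]
    [TopologicalSpace G] [IsTopologicalAddGroup G] [ContinuousSMul ℝ G] [PolynormableSpace ℝ G]
    [T2Space G] (J : F →L[ℝ] G) (hJ : IsClosedEmbedding J) (hU : IsOpen U)
    (h : RealAnalyticOn (fun x => J (f x)) U) : RealAnalyticOn f U := by
  obtain ⟨W, g, hW, hUW, hg, hgf⟩ := h
  have hJ' := isClosedEmbedding_mapCLM hJ
  have hT : IsOpen (complexTube U W) := isOpen_complexTube hU hW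
  have hmem : ∀ w ∈ complexTube U W, ∃ y, mapCLM J y = g w := by
    intro w hw
    refine mem_of_forall_strongDual (Y := (mapCLM J).range) ?_ fun q hq => ?_
    · exact hJ'.isClosed_range
    · refine eq_of_eq_on_real hU hW hW hg hg q 0 (fun x hx => ?_) hw.1 hw.2 hw.2
      rw [hgf x hx, ← mapCLM_ofReal]
      simpa using hq (mapCLM J (ofReal (f x))) ⟨_, rfl⟩
  choose! e he using hmem
  refine ⟨complexTube U W, e, hT, fun x hx => ofReal_mem_complexTube hx (hUW x hx),
    ComplexAnalyticOn.of_comp_isClosedEmbedding (mapCLM J) hJ' hT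
      ((hg.mono hW hT complexTube_subset).congr hT fun w hw => (he w hw).symm), fun x hx => ?_⟩
  apply hJ'.injective
  rw [he _ (ofReal_mem_complexTube hx (hUW x hx)), hgf x hx, mapCLM_ofReal]

end Real

end LocallyConvexCalculus

/-! ### The three classes treated uniformly, and Hadamard derivatives -/

namespace CrClass

open LocallyConvexCalculus

section Calculus

variable {c : CrClass}
  {E : Type u} [AddCommGroup E] [Module c.field E] [TopologicalSpace E] [IsTopologicalAddGroup E]
  [ContinuousSMul c.field E] [PolynormableSpace c.field E] [T2Space E]
  {F : Type v} [AddCommGroup F] [Module c.field F] [TopologicalSpace F] [IsTopologicalAddGroup F]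
  [ContinuousSMul c.field F] [PolynormableSpace c.field F] [T2Space F]
  {G : Type w} [AddCommGroup G] [Module c.field G] [TopologicalSpace G] [IsTopologicalAddGroup G]
  [ContinuousSMul c.field G] [PolynormableSpace c.field G] [T2Space G]
  {f g : E → F} {U V : Set E}

theorem On.mono (h : c.On f U) (hU : IsOpen U) (hV : IsOpen V) (hVU : V ⊆ U) : c.On f V := by
  cases c with
  | real r hr => exact fun k hk => ckOn_iff_ckGen.2 ((ckOn_iff_ckGen.1 (h k hk)).mono hVU)
  | realAnalytic => exact RealAnalyticOn.mono (E := E) (F := F) h hVU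
  | complexAnalytic => exact ComplexAnalyticOn.mono (E := E) (F := F) h hU hV hVU

theorem On.congr (h : c.On f U) (hU : IsOpen U) (hfg : EqOn f g U) : c.On g U := by
  cases c with
  | real r hr => exact fun k hk => ckOn_iff_ckGen.2 ((ckOn_iff_ckGen.1 (h k hk)).congr hU hfg)
  | realAnalytic => exact RealAnalyticOn.congr (E := E) (F := F) h hfg
  | complexAnalytic => exact ComplexAnalyticOn.congr (E := E) (F := F) h hU hfg

theorem On.of_local (hU : IsOpen U) (h : ∀ x ∈ U, ∃ V, IsOpen V ∧ x ∈ V ∧ c.On f V) :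
    c.On f U := by
  cases c with
  | real r hr =>
    refine fun k hk => ckOn_iff_ckGen.2 (CkGen.of_local hU fun x hx => ?_)
    obtain ⟨V, hV, hxV, hf⟩ := h x hx
    exact ⟨V, hV, hxV, ckOn_iff_ckGen.1 (hf k hk)⟩
  | realAnalytic => exact RealAnalyticOn.of_local (E := E) (F := F) h
  | complexAnalytic => exact ComplexAnalyticOn.of_local (E := E) (F := F) hU h

theorem On.clm (A : E →L[c.field] F) (hU : IsOpen U) : c.On A U := by
  cases c with
  | real r hr => exact fun k hk => ckOn_iff_ckGen.2 (CkGen.clm (𝕜 := ℝ) (E := E) (F := F) A)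
  | realAnalytic => exact RealAnalyticOn.clm (E := E) (F := F) A
  | complexAnalytic => exact ComplexAnalyticOn.clm (E := E) (F := F) A hU

theorem On.add (hf : c.On f U) (hg : c.On g U) (hU : IsOpen U) : c.On (fun x => f x + g x) U := by
  cases c with
  | real r hr =>
    exact fun k hk => ckOn_iff_ckGen.2
      (CkGen.add (ckOn_iff_ckGen.1 (hf k hk)) (ckOn_iff_ckGen.1 (hg k hk)))
  | realAnalytic => exact RealAnalyticOn.add (E := E) (F := F) hf hg
  | complexAnalytic => exact ComplexAnalyticOn.add (E := E) (F := F) hf hg hU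

theorem On.comp {g : F → G} {V : Set F} (hg : c.On g V) (hf : c.On f U) (hU : IsOpen U)
    (hV : IsOpen V) (hfV : MapsTo f U V) : c.On (fun x => g (f x)) U := by
  cases c with
  | real r hr =>
    exact fun k hk => ckOn_iff_ckGen.2
      (CkGen.comp (ckOn_iff_ckGen.1 (hg k hk)) (ckOn_iff_ckGen.1 (hf k hk)) hV hfV)
  | realAnalytic => exact RealAnalyticOn.comp (E := E) (F := F) (G := G) hg hf hfV
  | complexAnalytic => exact ComplexAnalyticOn.comp (E := E) (F := F) (G := G) hg hf hU hV hfV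

theorem On.of_comp_isClosedEmbedding (J : F →L[c.field] G) (hJ : IsClosedEmbedding J)
    (hU : IsOpen U) (h : c.On (fun x => J (f x)) U) : c.On f U := by
  cases c with
  | real r hr =>
    exact fun k hk => ckOn_iff_ckGen.2
      (CkGen.of_comp_isClosedEmbedding (𝕜 := ℝ) (E := E) (F := F) (G := G) J hJ hU
        (ckOn_iff_ckGen.1 (h k hk)))
  | realAnalytic =>
    exact RealAnalyticOn.of_comp_isClosedEmbedding (E := E) (F := F) (G := G) J hJ hU h
  | complexAnalytic =>
    exact ComplexAnalyticOn.of_comp_isClosedEmbedding (E := E) (F := F) (G := G) J hJ hU h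

/-- `L` is the derivative of `f` at `x`, in the sense of Hadamard. -/
def HasHadamardDeriv (c : CrClass) {E : Type u} [AddCommGroup E] [Module c.field E]
    [TopologicalSpace E] {F : Type v} [AddCommGroup F] [Module c.field F] [TopologicalSpace F]
    (f : E → F) (L : E →L[c.field] F) (x : E) : Prop :=
  ∀ (v : E) (b : c.field → E), Tendsto b (𝓝[≠] 0) (𝓝 v) →
    Tendsto (fun t : c.field => t⁻¹ • (f (x + t • b t) - f x)) (𝓝[≠] 0) (𝓝 (L v))

theorem exists_hadamardDeriv_of_ckGen {𝕜 : Type} [RCLike 𝕜]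
    {E : Type u} [AddCommGroup E] [Module 𝕜 E] [TopologicalSpace E] [IsTopologicalAddGroup E]
    [ContinuousSMul 𝕜 E]
    {F : Type v} [AddCommGroup F] [Module 𝕜 F] [TopologicalSpace F] [IsTopologicalAddGroup F]
    [ContinuousSMul 𝕜 F] [PolynormableSpace 𝕜 F] [T2Space F] {f : E → F} {U : Set E}
    (h : CkGen 𝕜 1 f U) (hU : IsOpen U) {x : E} (hx : x ∈ U) :
    ∃ L : E →L[𝕜] F, ∀ (v : E) (b : 𝕜 → E), Tendsto b (𝓝[≠] 0) (𝓝 v) →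
      Tendsto (fun t : 𝕜 => t⁻¹ • (f (x + t • b t) - f x)) (𝓝[≠] 0) (𝓝 (L v)) := by
  obtain ⟨df, hdf, -⟩ := h.exists_hasContDirDeriv
  obtain ⟨L, hL⟩ := hdf.exists_clm hU hx
  refine ⟨L, fun v b hb => ?_⟩
  rw [hL]
  exact hdf.tendsto hU hx tendsto_id tendsto_const_nhds hb

theorem On.exists_hadamardDeriv (h : c.On f U) (hU : IsOpen U) {x : E} (hx : x ∈ U) :
    ∃ L : E →L[c.field] F, HasHadamardDeriv c f L x := by
  cases c with
  | real r hr =>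
    exact exists_hadamardDeriv_of_ckGen (𝕜 := ℝ) (E := E) (F := F)
      (ckOn_iff_ckGen.1 (h 1 (by simpa using hr))) hU hx
  | realAnalytic =>
    exact exists_hadamardDeriv_of_ckGen (𝕜 := ℝ) (E := E) (F := F)
      (RealAnalyticOn.ckGen_one (E := E) (F := F) h hU) hU hx
  | complexAnalytic =>
    exact exists_hadamardDeriv_of_ckGen (𝕜 := ℂ) (E := E) (F := F)
      (ComplexAnalyticOn.ckGen (E := E) (F := F) hU h 1) hU hx

theorem HasHadamardDeriv.hasDirDeriv {L : E →L[c.field] F} {x : E} (h : HasHadamardDeriv c f L x)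
    (v : E) : HasDirDeriv c.field f x v (L v) := h v _ tendsto_const_nhds

/-- The difference quotient of `f` is a direction varying with `t`. The Hadamard derivative of `g`
admits such directions, whereas a directional derivative would not. -/
theorem HasHadamardDeriv.comp {g : F → G} {A : F →L[c.field] G} {L : E →L[c.field] F} {x : E}
    (hg : HasHadamardDeriv c g A (f x)) (hf : HasHadamardDeriv c f L x) :
    HasHadamardDeriv c (fun y => g (f y)) (A.comp L) x := by
  intro v b hb
  refine (hg _ _ (hf v b hb)).congr' ?_
  filter_upwards [self_mem_nhdsWithin] with t ht
  have ht' : t ≠ 0 := ht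
  rw [smul_inv_smul₀ ht', add_sub_cancel]

theorem HasHadamardDeriv.clm (A : E →L[c.field] F) (x : E) : HasHadamardDeriv c A A x := by
  intro v b hb
  refine ((A.continuous.tendsto v).comp hb).congr' ?_
  filter_upwards [self_mem_nhdsWithin] with t ht
  have ht' : t ≠ 0 := ht
  rw [map_add, map_smul, add_sub_cancel_left, inv_smul_smul₀ ht', Function.comp_apply]

theorem eventually_add_smul_mem_nhds {x : E} (hU : U ∈ 𝓝 x) (v : E) :
    ∀ᶠ t : c.field in 𝓝[≠] 0, x + t • v ∈ U := by
  refine nhdsWithin_le_nhds ?_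
  exact (Continuous.tendsto' (by fun_prop) (0 : c.field) x (by simp)).eventually hU

theorem HasHadamardDeriv.eq_of_eventuallyEq {L L' : E →L[c.field] F} {x : E}
    (hf : HasHadamardDeriv c f L x) (hg : HasHadamardDeriv c g L' x) (h : f =ᶠ[𝓝 x] g) :
    L = L' := by
  ext v
  refine tendsto_nhds_unique (hf.hasDirDeriv v) (Tendsto.congr' ?_ (hg.hasDirDeriv v))
  filter_upwards [eventually_add_smul_mem_nhds h v] with t ht
  have ht' : f (x + t • v) = g (x + t • v) := ht
  rw [ht', h.self_of_nhds]

end Calculus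

end CrClass

/-! ### Charts, transitions and submanifold charts -/

namespace CrClass

section Charts

variable {c : CrClass}
  {E : Type u} [AddCommGroup E] [Module c.field E] [TopologicalSpace E] [IsTopologicalAddGroup E]
  [ContinuousSMul c.field E] [PolynormableSpace c.field E] [T2Space E]
  {F : Type v} [AddCommGroup F] [Module c.field F] [TopologicalSpace F] [IsTopologicalAddGroup F]
  [ContinuousSMul c.field F] [PolynormableSpace c.field F] [T2Space F]
  {M : Type w} [TopologicalSpace M] [ChartedSpace E M]
  {N : Type z} [TopologicalSpace N] [ChartedSpace F N]

theorem isChart_chartAt [c.IsCrManifold E M] (x : M) : c.IsChart (chartAt E x) :=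
  IsCrManifold.isChart_of_mem_atlas _ (chart_mem_atlas E x)

/-- Near each point the transition factors through a chart of the given atlas, and being `C^r` is
local. -/
theorem IsChart.on_transition {φ ψ : OpenPartialHomeomorph M E} (hφ : c.IsChart φ)
    (hψ : c.IsChart ψ) : c.On (fun y => ψ (φ.symm y)) (φ.symm.trans ψ).source := by
  refine On.of_local (φ.symm.trans ψ).open_source fun y hy => ?_
  set e := chartAt E (φ.symm y) with he
  have hV : IsOpen ((φ.symm.trans e).source ∩ (φ.symm.trans ψ).source) :=
    (φ.symm.trans e).open_source.inter (φ.symm.trans ψ).open_source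
  refine ⟨_, hV, ⟨?_, hy⟩, ?_⟩
  · rw [OpenPartialHomeomorph.trans_source] at hy ⊢
    exact ⟨hy.1, mem_chart_source E (φ.symm y)⟩
  · have h1 := hφ e (chart_mem_atlas E _)
    have h2 := hψ e (chart_mem_atlas E _)
    refine ((h2.2.comp (h1.1.mono (φ.symm.trans e).open_source hV inter_subset_left) hV
      (e.symm.trans ψ).open_source ?_)).congr hV ?_
    · rintro y ⟨hy1, hy2⟩
      simp only [OpenPartialHomeomorph.trans_source, OpenPartialHomeomorph.symm_source, mem_inter_iff,
        mem_preimage] at hy1 hy2 ⊢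
      exact ⟨e.map_source hy1.2, by rw [e.left_inv hy1.2]; exact hy2.2⟩
    · rintro y ⟨hy1, hy2⟩
      simp only [OpenPartialHomeomorph.trans_source, mem_inter_iff, mem_preimage] at hy1
      simp only [e.left_inv hy1.2]

theorem IsChart.trans {φ : OpenPartialHomeomorph M E} (hφ : c.IsChart φ)
    {Φ : OpenPartialHomeomorph E E} (hΦ : c.On Φ Φ.source) (hΦ' : c.On Φ.symm Φ.target) :
    c.IsChart (φ.trans Φ) := by
  intro e he
  have h := hφ e he
  constructor
  · have hO := ((φ.trans Φ).symm.trans e).open_source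
    refine h.1.comp (hΦ'.mono Φ.open_target hO ?_) hO (φ.symm.trans e).open_source ?_
    · intro y hy
      simp only [mfld_simps] at hy
      exact hy.1.1
    · intro y hy
      simp only [mfld_simps] at hy ⊢
      exact ⟨hy.1.2, hy.2⟩
  · have hO := (e.symm.trans (φ.trans Φ)).open_source
    refine hΦ.comp (h.2.mono (e.symm.trans φ).open_source hO ?_) hO Φ.open_source ?_
    · intro y hy
      simp only [mfld_simps] at hy ⊢
      exact ⟨hy.1, hy.2.1⟩
    · intro y hy
      simp only [mfld_simps] at hy
      exact hy.2.2

theorem IsMap.on_charts {f : M → N} (hf : c.IsMap E F f) {φ : OpenPartialHomeomorph M E}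
    {ψ : OpenPartialHomeomorph N F} (hφ : c.IsChart φ) (hψ : c.IsChart ψ) :
    c.On (fun y => ψ (f (φ.symm y))) (φ.target ∩ φ.symm ⁻¹' (f ⁻¹' ψ.source)) := by
  have hopen : ∀ (φ : OpenPartialHomeomorph M E) (ψ : OpenPartialHomeomorph N F),
      IsOpen (φ.target ∩ φ.symm ⁻¹' (f ⁻¹' ψ.source)) := fun φ ψ =>
    φ.isOpen_inter_preimage_symm (ψ.open_source.preimage hf.1)
  refine On.of_local (hopen φ ψ) fun y hy => ?_
  set e := chartAt E (φ.symm y) with he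
  set d := chartAt F (f (φ.symm y)) with hd
  have hV : IsOpen ((φ.symm.trans e).source ∩ (φ.target ∩ φ.symm ⁻¹' (f ⁻¹' ψ.source)) ∩
      (φ.target ∩ φ.symm ⁻¹' (f ⁻¹' d.source))) :=
    ((φ.symm.trans e).open_source.inter (hopen φ ψ)).inter (hopen φ d)
  refine ⟨_, hV, ⟨⟨?_, hy⟩, hy.1, mem_chart_source F (f (φ.symm y))⟩, ?_⟩
  · rw [OpenPartialHomeomorph.trans_source]
    exact ⟨hy.1, mem_chart_source E (φ.symm y)⟩
  · have h1 := (hφ e (chart_mem_atlas E _)).1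
    have h2 := hf.2 e (chart_mem_atlas E _) d (chart_mem_atlas F _)
    have h3 := (hψ d (chart_mem_atlas F _)).2
    have hV1 := h1.mono (φ.symm.trans e).open_source hV fun y hy => hy.1.1
    have h4 := h2.comp hV1 hV (hopen e d) ?_
    · refine ((h3.comp h4 hV (d.symm.trans ψ).open_source) ?_).congr hV ?_
      · rintro y ⟨⟨hy1, hy2⟩, hy3⟩
        simp only [mfld_simps] at hy1 hy2 hy3 ⊢
        rw [e.left_inv hy1.2]
        exact ⟨d.map_source hy3.2, by rw [d.left_inv hy3.2]; exact hy2.2⟩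
      · rintro y ⟨⟨hy1, hy2⟩, hy3⟩
        simp only [mfld_simps] at hy1 hy2 hy3
        simp only [e.left_inv hy1.2, d.left_inv hy3.2]
    · rintro y ⟨⟨hy1, hy2⟩, hy3⟩
      simp only [mfld_simps] at hy1 hy2 hy3 ⊢
      exact ⟨e.map_source hy1.2, by rw [e.left_inv hy1.2]; exact hy3.2⟩

/-- The derivative of a change of charts is an isomorphism. -/
theorem IsChart.exists_deriv_transition {φ ψ : OpenPartialHomeomorph M E} (hφ : c.IsChart φ)
    (hψ : c.IsChart ψ) {x : M} (hx : x ∈ φ.source) (hx' : x ∈ ψ.source) :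
    ∃ A : E ≃L[c.field] E, HasHadamardDeriv c (fun y => ψ (φ.symm y)) (A : E →L[c.field] E) (φ x) ∧
      HasHadamardDeriv c (fun y => φ (ψ.symm y)) (A.symm : E →L[c.field] E) (ψ x) := by
  have key : ∀ {φ ψ : OpenPartialHomeomorph M E}, c.IsChart φ → c.IsChart ψ → x ∈ φ.source →
      x ∈ ψ.source → ∀ {L L' : E →L[c.field] E},
      HasHadamardDeriv c (fun y => ψ (φ.symm y)) L (φ x) →
      HasHadamardDeriv c (fun y => φ (ψ.symm y)) L' (ψ x) →
      L'.comp L = ContinuousLinearMap.id c.field E := by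
    intro φ ψ hφ hψ hx hx' L L' h h'
    have h1 : HasHadamardDeriv c (fun y => φ (ψ.symm y)) L' (ψ (φ.symm (φ x))) := by
      rwa [φ.left_inv hx]
    refine (HasHadamardDeriv.comp (f := fun y => ψ (φ.symm y)) h1 h).eq_of_eventuallyEq
      (HasHadamardDeriv.clm (ContinuousLinearMap.id c.field E) _) ?_
    have hm : φ x ∈ (φ.symm.trans ψ).source := by
      simp only [mfld_simps, hx, hx']
    filter_upwards [(φ.symm.trans ψ).open_source.mem_nhds hm] with y hy
    simp only [mfld_simps] at hy
    rw [ψ.left_inv hy.2, φ.right_inv hy.1, ContinuousLinearMap.id_apply]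
  have hex : ∀ {φ ψ : OpenPartialHomeomorph M E}, c.IsChart φ → c.IsChart ψ → x ∈ φ.source →
      x ∈ ψ.source → ∃ L, HasHadamardDeriv c (fun y => ψ (φ.symm y)) L (φ x) := by
    intro φ ψ hφ hψ hx hx'
    exact (hφ.on_transition hψ).exists_hadamardDeriv (φ.symm.trans ψ).open_source
      (by simp only [mfld_simps, hx, hx'])
  obtain ⟨L, hL⟩ := hex hφ hψ hx hx'
  obtain ⟨L', hL'⟩ := hex hψ hφ hx' hx
  refine ⟨ContinuousLinearEquiv.equivOfInverse L L' (fun v => ?_) (fun v => ?_), hL, hL'⟩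
  · exact congrArg (fun A : E →L[c.field] E => A v) (key hφ hψ hx hx' hL hL')
  · exact congrArg (fun A : E →L[c.field] E => A v) (key hψ hφ hx' hx hL' hL)

end Charts

section SubmanifoldCharts

variable {c : CrClass}
  {E : Type u} [AddCommGroup E] [Module c.field E] [TopologicalSpace E] [IsTopologicalAddGroup E]
  [ContinuousSMul c.field E] [PolynormableSpace c.field E] [T2Space E]
  {M : Type w} [TopologicalSpace M] [ChartedSpace E M]
  {Y Z : Submodule c.field E} {S : Set M} {φ ψ : OpenPartialHomeomorph M E}

theorem IsSubmanifoldChart.mem_iff (h : c.IsSubmanifoldChart Y S φ) {x : M} (hx : x ∈ φ.source) :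
    x ∈ S ↔ φ x ∈ Y := by
  refine ⟨fun hS => (h.image_eq.subset ⟨x, ⟨hx, hS⟩, rfl⟩).2, fun hY => ?_⟩
  obtain ⟨y, ⟨hy, hyS⟩, hyx⟩ := h.image_eq.superset ⟨φ.map_source hx, hY⟩
  rwa [← φ.injOn hy hx hyx]

theorem IsSubmanifoldChart.symm_mem_iff (h : c.IsSubmanifoldChart Y S φ) {y : E}
    (hy : y ∈ φ.target) : φ.symm y ∈ S ↔ y ∈ Y := by
  rw [h.mem_iff (φ.map_target hy), φ.right_inv hy]

theorem isSubmanifoldChart_of_mem_iff (hφ : c.IsChart φ)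
    (h : ∀ x ∈ φ.source, x ∈ S ↔ φ x ∈ Y) : c.IsSubmanifoldChart Y S φ := by
  refine ⟨hφ, Subset.antisymm ?_ ?_⟩
  · rintro _ ⟨x, ⟨hx, hxS⟩, rfl⟩
    exact ⟨φ.map_source hx, (h x hx).1 hxS⟩
  · rintro y ⟨hy, hyY⟩
    refine ⟨φ.symm y, ⟨φ.map_target hy, (h _ (φ.map_target hy)).2 ?_⟩, φ.right_inv hy⟩
    rwa [φ.right_inv hy]

/-- The derivative of a change of submanifold charts maps one model subspace onto the other. -/
theorem IsSubmanifoldChart.exists_deriv_transition (hφ : c.IsSubmanifoldChart Y S φ)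
    (hψ : c.IsSubmanifoldChart Z S ψ) (hY : IsClosed (Y : Set E)) (hZ : IsClosed (Z : Set E))
    {x : M} (hxS : x ∈ S) (hx : x ∈ φ.source) (hx' : x ∈ ψ.source) :
    ∃ A : E ≃L[c.field] E, HasHadamardDeriv c (fun y => ψ (φ.symm y)) (A : E →L[c.field] E) (φ x) ∧
      ∀ v, v ∈ Y ↔ A v ∈ Z := by
  have key : ∀ {Y Z : Submodule c.field E} {φ ψ : OpenPartialHomeomorph M E}
      {A : E →L[c.field] E}, c.IsSubmanifoldChart Y S φ → c.IsSubmanifoldChart Z S ψ →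
      IsClosed (Z : Set E) → x ∈ φ.source → x ∈ ψ.source →
      HasHadamardDeriv c (fun y => ψ (φ.symm y)) A (φ x) → ∀ v ∈ Y, A v ∈ Z := by
    intro Y Z φ ψ A hφ hψ hZ hx hx' hA v hv
    -- Along `φ x + t v` with `v ∈ Y` the transition takes values in `Z`, so its difference
    -- quotients lie in `Z`; closedness passes this to the limit `A v`.
    refine hZ.mem_of_tendsto (hA.hasDirDeriv v) ?_
    have hm : φ x ∈ (φ.symm.trans ψ).source := by simp only [mfld_simps, hx, hx']
    filter_upwards [eventually_add_smul_mem_nhds ((φ.symm.trans ψ).open_source.mem_nhds hm) v]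
      with t ht
    simp only [mfld_simps] at ht
    refine Z.smul_mem _ (Z.sub_mem ?_ ?_)
    · rw [← hψ.mem_iff ht.2, hφ.symm_mem_iff ht.1]
      exact Y.add_mem ((hφ.mem_iff hx).1 hxS) (Y.smul_mem t hv)
    · rw [φ.left_inv hx]
      exact (hψ.mem_iff hx').1 hxS
  obtain ⟨A, hA, hA'⟩ := hφ.isChart.exists_deriv_transition hψ.isChart hx hx'
  refine ⟨A, hA, fun v => ⟨key hφ hψ hZ hx hx' hA v, fun hv => ?_⟩⟩
  simpa using key hψ hφ hY hx' hx hA' (A v) hv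

theorem IsChart.trans_equiv (hφ : c.IsChart φ) (A : E ≃L[c.field] E) :
    c.IsChart (φ.trans A.toHomeomorph.toOpenPartialHomeomorph) :=
  hφ.trans (On.clm (A : E →L[c.field] E) isOpen_univ) (On.clm (A.symm : E →L[c.field] E) isOpen_univ)

theorem IsSubmanifoldChart.trans_equiv (h : c.IsSubmanifoldChart Y S φ) (A : E ≃L[c.field] E)
    (hA : ∀ v, v ∈ Y ↔ A v ∈ Z) :
    c.IsSubmanifoldChart Z S (φ.trans A.toHomeomorph.toOpenPartialHomeomorph) := by
  refine isSubmanifoldChart_of_mem_iff (h.isChart.trans_equiv A) fun x hx => ?_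
  have hx' : x ∈ φ.source := by simpa using hx
  rw [h.mem_iff hx', hA]
  rfl

theorem IsRestriction.symm_apply_eq {e : OpenPartialHomeomorph S Y} (he : IsRestriction φ e) {y : Y}
    (hy : y ∈ e.target) : (e.symm y : M) = φ.symm y := by
  have h1 := e.map_target hy
  have h2 : (e.symm y : M) ∈ φ.source := by
    rw [he.source_eq] at h1
    exact h1
  rw [← φ.left_inv h2, ← he.apply_eq _ h1, e.right_inv hy]

/-- Followed by the inclusion into `E`, this is the ambient transition restricted to `Y`. The
inclusion is a closed embedding, so the map is `C^r` into `Y` as well. -/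
theorem on_transition_restriction (hφ : c.IsSubmanifoldChart Y S φ)
    (hψ : c.IsSubmanifoldChart Y S ψ) (hY : IsClosed (Y : Set E)) {e d : OpenPartialHomeomorph S Y}
    (he : IsRestriction φ e) (hd : IsRestriction ψ d) :
    c.On (fun y => d (e.symm y)) (e.symm.trans d).source := by
  have hO := (e.symm.trans d).open_source
  refine On.of_comp_isClosedEmbedding Y.subtypeL hY.isClosedEmbedding_subtypeVal hO ?_
  have hmem : ∀ y ∈ (e.symm.trans d).source, y ∈ e.target ∧ e.symm y ∈ d.source := by
    intro y hy
    simpa only [mfld_simps] using hy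
  refine ((hφ.isChart.on_transition hψ.isChart).comp (On.clm Y.subtypeL hO) hO
    (φ.symm.trans ψ).open_source fun y hy => ?_).congr hO fun y hy => ?_
  · obtain ⟨h1, h2⟩ := hmem y hy
    have h3 : φ.symm (y : E) ∈ ψ.source := by
      rw [← he.symm_apply_eq h1]
      rw [hd.source_eq] at h2
      exact h2
    rw [he.target_eq] at h1
    rw [OpenPartialHomeomorph.trans_source]
    exact ⟨h1, h3⟩
  · obtain ⟨h1, h2⟩ := hmem y hy
    show ψ (φ.symm y) = (d (e.symm y) : E)
    rw [hd.apply_eq _ h2, he.symm_apply_eq h1]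

theorem IsSubmanifold.isChart_restriction (h : c.IsSubmanifold Y S)
    (hφ : c.IsSubmanifoldChart Y S φ) {e : OpenPartialHomeomorph S Y} (he : IsRestriction φ e) :
    letI := h.chartedSpace
    c.IsChart e := by
  rintro d ⟨ψ, hψ, hd⟩
  exact ⟨on_transition_restriction hφ hψ h.isClosed he hd,
    on_transition_restriction hψ hφ h.isClosed hd he⟩

end SubmanifoldCharts

end CrClass

/-! ### Tangent spaces, shears and the normal form of a submersion -/

namespace CrClass

section Tangent

variable {c : CrClass}
  {E : Type u} [AddCommGroup E] [Module c.field E] [TopologicalSpace E] [IsTopologicalAddGroup E]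
  [ContinuousSMul c.field E] [PolynormableSpace c.field E] [T2Space E]
  {F : Type v} [AddCommGroup F] [Module c.field F] [TopologicalSpace F] [IsTopologicalAddGroup F]
  [ContinuousSMul c.field F] [PolynormableSpace c.field F] [T2Space F]
  {M : Type w} [TopologicalSpace M] [ChartedSpace E M]
  {N : Type z} [TopologicalSpace N] [ChartedSpace F N]
  {Y Z : Submodule c.field E} {S : Set M}

theorem tangentMap_eq_of_hasHadamardDeriv {f : M → N} {x : M} {L : E →L[c.field] F}
    (h : HasHadamardDeriv c (fun y => chartAt F (f x) (f ((chartAt E x).symm y))) L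
      (chartAt E x x)) (v : E) : c.tangentMap E F f x v = L v :=
  (h.hasDirDeriv v).limUnder_eq

/-- The tangent space of a submanifold, read in an arbitrary submanifold chart. -/
theorem IsSubmanifold.mem_tangent_iff [c.IsCrManifold E M] (h : c.IsSubmanifold Y S) (s : S)
    {φ : OpenPartialHomeomorph M E} (hφ : c.IsSubmanifoldChart Z S φ) (hZ : IsClosed (Z : Set E))
    (hs : (s : M) ∈ φ.source) {D : E →L[c.field] E}
    (hD : HasHadamardDeriv c (fun y => φ ((chartAt E (s : M)).symm y)) D (chartAt E (s : M) s))
    (w : E) : w ∈ h.tangent s ↔ D w ∈ Z := by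
  let inst := h.chartedSpace
  obtain ⟨φ₀, hφ₀, he⟩ := chart_mem_atlas Y s
  set e := chartAt Y s with he0
  have hse : s ∈ e.source := mem_chart_source Y s
  have hs₀ : (s : M) ∈ φ₀.source := by
    have := hse
    rw [he.source_eq] at this
    exact this
  set κ := chartAt E (s : M) with hκ
  have hsκ : (s : M) ∈ κ.source := mem_chart_source E (s : M)
  obtain ⟨A, hA, -⟩ := hφ₀.isChart.exists_deriv_transition (isChart_chartAt (c := c) (s : M)) hs₀ hsκ
  obtain ⟨T, hT, hTY⟩ := hφ₀.exists_deriv_transition hφ h.isClosed hZ s.2 hs₀ hs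
  have hes : ((e s : Y) : E) = φ₀ s := he.apply_eq s hse
  -- In the preferred charts the inclusion of `S` is `κ ∘ φ₀⁻¹` restricted to `Y`, so the tangent
  -- space is `A (Y)`.
  have htan : ∀ v : Y, c.tangentMap Y E (Subtype.val : S → M) s v = A v := by
    intro v
    have hA' : HasHadamardDeriv c (fun y => κ (φ₀.symm y)) (A : E →L[c.field] E)
        (Y.subtypeL (e s)) := by
      have : Y.subtypeL (e s) = φ₀ s := hes
      rwa [this]
    have h1 := hA'.comp (HasHadamardDeriv.clm Y.subtypeL (e s))
    refine Tendsto.limUnder_eq (Tendsto.congr' ?_ (h1.hasDirDeriv v))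
    filter_upwards [eventually_add_smul_mem_nhds (e.open_target.mem_nhds (e.map_source hse)) v]
      with t ht
    have h2 : ∀ y ∈ e.target, κ (φ₀.symm (Y.subtypeL y)) = κ (e.symm y : M) := by
      intro y hy
      rw [he.symm_apply_eq hy]
      rfl
    rw [h2 _ ht, h2 _ (e.map_source hse)]
  -- Chain rule through `κ`. As `T` matches `Y` with `Z`, it follows that `D` matches `A (Y)` with
  -- `Z`.
  have hDA : D.comp (A : E →L[c.field] E) = T := by
    have hD' : HasHadamardDeriv c (fun y => φ (κ.symm y)) D (κ (φ₀.symm (φ₀ s))) := by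
      rwa [φ₀.left_inv hs₀]
    refine (HasHadamardDeriv.comp (f := fun y => κ (φ₀.symm y)) hD' hA).eq_of_eventuallyEq hT ?_
    have hm : φ₀ s ∈ (φ₀.symm.trans κ).source := by simp only [mfld_simps, hs₀, hsκ]
    filter_upwards [(φ₀.symm.trans κ).open_source.mem_nhds hm] with y hy
    simp only [mfld_simps] at hy
    rw [κ.left_inv hy.2]
  have hDA' : ∀ v, D (A v) = T v := fun v => congrArg (fun B : E →L[c.field] E => B v) hDA
  constructor
  · rintro ⟨v, rfl⟩
    rw [htan v, hDA', ← hTY]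
    exact v.2
  · intro hw
    have hv : A.symm w ∈ Y := by
      rw [hTY, ← hDA', A.apply_symm_apply]
      exact hw
    refine ⟨⟨A.symm w, hv⟩, ?_⟩
    rw [htan]
    exact A.apply_symm_apply w

end Tangent

section Shear

variable {c : CrClass}
  {E : Type u} [AddCommGroup E] [Module c.field E] [TopologicalSpace E] [IsTopologicalAddGroup E]
  [ContinuousSMul c.field E] [PolynormableSpace c.field E] [T2Space E]
  {F : Type v} [AddCommGroup F] [Module c.field F] [TopologicalSpace F] [IsTopologicalAddGroup F]
  [ContinuousSMul c.field F] [PolynormableSpace c.field F] [T2Space F]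

/-- Because `π ∘ σ = id`, the correction along `σ` changes `π y` into `T (π y)`. The shear by `T'`
then adds the opposite correction. -/
theorem shear_aux (π : E →L[c.field] F) (σ : F →L[c.field] E) (hπσ : ∀ y, π (σ y) = y)
    (T T' : F → F) (y : E) (hy : T' (T (π y)) = π y) :
    π (y + σ (T (π y) - π y)) = T (π y) ∧
      y + σ (T (π y) - π y) + σ (T' (π (y + σ (T (π y) - π y))) - π (y + σ (T (π y) - π y))) = y := by
  have h1 : π (y + σ (T (π y) - π y)) = T (π y) := by
    rw [map_add, hπσ, add_sub_cancel]
  refine ⟨h1, ?_⟩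
  rw [h1, hy, add_assoc, ← map_add, sub_add_sub_cancel', sub_self, map_zero, add_zero]

/-- The lift `y ↦ y + σ (T (π y) - π y)` of a local homeomorphism `T` along a split surjection
`π`. -/
noncomputable def shear (π : E →L[c.field] F) (σ : F →L[c.field] E) (hπσ : ∀ y, π (σ y) = y)
    (T : OpenPartialHomeomorph F F) : OpenPartialHomeomorph E E where
  toFun y := y + σ (T (π y) - π y)
  invFun y := y + σ (T.symm (π y) - π y)
  source := π ⁻¹' T.source
  target := π ⁻¹' T.target
  map_source' y hy := by
    rw [mem_preimage, (shear_aux π σ hπσ T T.symm y (T.left_inv hy)).1]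
    exact T.map_source hy
  map_target' y hy := by
    rw [mem_preimage, (shear_aux π σ hπσ T.symm T y (T.right_inv hy)).1]
    exact T.map_target hy
  left_inv' y hy := (shear_aux π σ hπσ T T.symm y (T.left_inv hy)).2
  right_inv' y hy := (shear_aux π σ hπσ T.symm T y (T.right_inv hy)).2
  open_source := T.open_source.preimage π.continuous
  open_target := T.open_target.preimage π.continuous
  continuousOn_toFun := continuousOn_id.add (σ.continuous.comp_continuousOn
    ((T.continuousOn.comp π.continuous.continuousOn fun _ hy => hy).sub π.continuous.continuousOn))
  continuousOn_invFun := continuousOn_id.add (σ.continuous.comp_continuousOn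
    ((T.continuousOn_symm.comp π.continuous.continuousOn fun _ hy => hy).sub
      π.continuous.continuousOn))

theorem on_shear_aux (π : E →L[c.field] F) (σ : F →L[c.field] E) {T : F → F} {V : Set F}
    (hV : IsOpen V) (hT : c.On T V) :
    c.On (fun y => y + σ (T (π y) - π y)) (π ⁻¹' V) := by
  have hO : IsOpen (π ⁻¹' V) := hV.preimage π.continuous
  have h1 : c.On (fun y => T (π y)) (π ⁻¹' V) :=
    hT.comp (On.clm π hO) hO hV fun _ hy => hy
  have h2 : c.On (fun y => σ (T (π y))) (π ⁻¹' V) :=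
    (On.clm σ isOpen_univ).comp h1 hO isOpen_univ (mapsTo_univ _ _)
  refine ((On.clm (ContinuousLinearMap.id c.field E - σ.comp π) hO).add h2 hO).congr hO fun y _ => ?_
  simp only [sub_apply, ContinuousLinearMap.id_apply,
    ContinuousLinearMap.comp_apply, map_sub]
  abel

end Shear

section NormalForm

variable {c : CrClass}
  {E : Type u} [AddCommGroup E] [Module c.field E] [TopologicalSpace E] [IsTopologicalAddGroup E]
  [ContinuousSMul c.field E] [PolynormableSpace c.field E] [T2Space E]
  {F : Type v} [AddCommGroup F] [Module c.field F] [TopologicalSpace F] [IsTopologicalAddGroup F]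
  [ContinuousSMul c.field F] [PolynormableSpace c.field F] [T2Space F]
  {M : Type w} [TopologicalSpace M] [ChartedSpace E M]
  {N : Type z} [TopologicalSpace N] [ChartedSpace F N]
  {Y : Submodule c.field F} {S : Set N} {f : M → N}

theorem isPreconnected_closedBall_field (r : ℝ) :
    IsPreconnected (Metric.closedBall (0 : c.field) r) := by
  cases c with
  | real _ _ => exact (convex_closedBall (0 : ℝ) r).isPreconnected
  | realAnalytic => exact (convex_closedBall (0 : ℝ) r).isPreconnected
  | complexAnalytic => exact (convex_closedBall (0 : ℂ) r).isPreconnected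

/-- Every neighbourhood of a point of a subspace contains an open neighbourhood whose intersection
with the subspace is connected. -/
theorem exists_isOpen_inter_isPreconnected (Z : Submodule c.field E) {p : E} (hp : p ∈ Z)
    {V : Set E} (hV : V ∈ 𝓝 p) :
    ∃ W ⊆ V, IsOpen W ∧ p ∈ W ∧ IsPreconnected (W ∩ (Z : Set E)) := by
  have h1 : (fun v => p + v) ⁻¹' V ∈ 𝓝 (0 : E) :=
    (Continuous.tendsto' (f := fun v : E => p + v) (by fun_prop) 0 p (by simp)) hV
  -- Balancedness is enough: each point of the subspace in `p + B` is joined to `p` by an image of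
  -- the scalar unit ball, inside both the neighbourhood and the subspace.
  obtain ⟨B, ⟨hB, hBb⟩, hBV⟩ := (nhds_basis_balanced c.field E).mem_iff.1 h1
  have hB0 : (0 : E) ∈ interior B := mem_interior_iff_mem_nhds.2 hB
  have hb := hBb.interior hB0
  refine ⟨(fun v => v - p) ⁻¹' interior B, fun y hy => ?_,
    isOpen_interior.preimage (by fun_prop), by simpa using hB0, ?_⟩
  · simpa using hBV (interior_subset hy)
  · refine isPreconnected_of_forall p fun y hy =>
      ⟨(fun t : c.field => p + t • (y - p)) '' Metric.closedBall 0 1, ?_, ⟨0, by simp⟩,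
        ⟨1, by simp⟩, (isPreconnected_closedBall_field 1).image _
          (Continuous.continuousOn (by fun_prop))⟩
    rintro _ ⟨t, ht, rfl⟩
    refine ⟨?_, Z.add_mem hp (Z.smul_mem t (Z.sub_mem hy.2 hp))⟩
    have := hb.smul_mem (mem_closedBall_zero_iff.1 ht) hy.1
    simpa using this

/-- Around each point of the preimage of a submanifold, a submersion is a linear projection with
respect to a submanifold chart of the target. -/
theorem IsSubmersion.exists_normalForm [c.IsCrManifold E M] [c.IsCrManifold F N]
    (hf : c.IsSubmersion E F f) (hS : c.IsSubmanifold Y S) {x : M} (hx : f x ∈ S) :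
    ∃ (φ : OpenPartialHomeomorph M E) (θ : OpenPartialHomeomorph N F) (π : E →L[c.field] F)
      (σ : F →L[c.field] E), c.IsChart φ ∧ c.IsSubmanifoldChart Y S θ ∧ x ∈ φ.source ∧
      MapsTo f φ.source θ.source ∧ (∀ y, π (σ y) = y) ∧ (∀ u ∈ φ.source, θ (f u) = π (φ u)) ∧
      IsPreconnected (φ.source ∩ f ⁻¹' S) := by
  obtain ⟨φ₀, ψ₀, π, σ, hφ₀, hψ₀, hxφ, hxψ, hmaps, hπσ, hπ⟩ := hf.2 x
  obtain ⟨θ, hθ, hxθ⟩ := hS.exists_chart (f x) hx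
  have hπ' : ∀ u ∈ φ₀.source, ψ₀ (f u) = π (φ₀ u) := fun u hu => by
    rw [← hπ _ (φ₀.map_source hu), φ₀.left_inv hu]
  set T := ψ₀.symm.trans θ with hT
  have hTs : ∀ u ∈ φ₀.source, π (φ₀ u) ∈ T.source ↔ f u ∈ θ.source := by
    intro u hu
    rw [← hπ' u hu, hT]
    simp only [mfld_simps, hmaps hu]
  -- The shear lifts `T` through `π`: it replaces `ψ₀` by `θ` in the target and leaves `π`
  -- unchanged.
  set Φ := shear π σ hπσ T with hΦ
  have hΦc : c.IsChart (φ₀.trans Φ) := by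
    refine hφ₀.trans (on_shear_aux π σ T.open_source (hψ₀.on_transition hθ.isChart)) ?_
    have h1 := (hθ.isChart.on_transition hψ₀).mono (V := T.target) (θ.symm.trans ψ₀).open_source
      T.open_target ?_
    · exact on_shear_aux π σ T.open_target h1
    · intro y hy
      simpa only [hT, mfld_simps] using hy
  have hΦmem : ∀ u, u ∈ (φ₀.trans Φ).source ↔ u ∈ φ₀.source ∧ f u ∈ θ.source := by
    intro u
    rw [OpenPartialHomeomorph.trans_source]
    exact and_congr_right fun hu => hTs u hu
  have hΦeq : ∀ u ∈ (φ₀.trans Φ).source, θ (f u) = π ((φ₀.trans Φ) u) := by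
    intro u hu
    obtain ⟨hu1, hu2⟩ := (hΦmem u).1 hu
    have h1 := (shear_aux π σ hπσ T T.symm (φ₀ u) (T.left_inv ((hTs u hu1).2 hu2))).1
    have h2 : π ((φ₀.trans Φ) u) = T (π (φ₀ u)) := h1
    rw [h2, ← hπ' u hu1]
    simp only [hT, mfld_simps, ψ₀.left_inv (hmaps hu1)]
  set φ₁ := φ₀.trans Φ with hφ₁
  have hx1 : x ∈ φ₁.source := (hΦmem x).2 ⟨hxφ, hxθ⟩
  have hSiff : ∀ u ∈ φ₁.source, f u ∈ S ↔ π (φ₁ u) ∈ Y := fun u hu => by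
    rw [hθ.mem_iff ((hΦmem u).1 hu).2, hΦeq u hu]
  -- The chart is shrunk so that its part of `f ⁻¹' S`, the image of `W ∩ π ⁻¹ (Y)`, is connected.
  obtain ⟨W, hWV, hW, hxW, hWc⟩ := exists_isOpen_inter_isPreconnected
    (Y.comap (π : E →ₗ[c.field] F)) ((hSiff x hx1).1 hx) (φ₁.open_target.mem_nhds (φ₁.map_source hx1))
  set φ := φ₁.trans (OpenPartialHomeomorph.ofSet W hW) with hφ
  have hφs : ∀ u, u ∈ φ.source ↔ u ∈ φ₁.source ∧ φ₁ u ∈ W := by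
    intro u
    simp only [hφ, mfld_simps]
  refine ⟨φ, θ, π, σ, hΦc.trans (On.clm (ContinuousLinearMap.id c.field E) hW)
    (On.clm (ContinuousLinearMap.id c.field E) hW), hθ, (hφs x).2 ⟨hx1, hxW⟩,
    fun u hu => ((hΦmem u).1 ((hφs u).1 hu).1).2, hπσ, fun u hu => hΦeq u ((hφs u).1 hu).1, ?_⟩
  have himg : φ.source ∩ f ⁻¹' S = φ₁.symm '' (W ∩ (Y.comap (π : E →ₗ[c.field] F) : Set E)) := by
    ext u
    constructor
    · rintro ⟨hu, huS⟩
      obtain ⟨hu1, hu2⟩ := (hφs u).1 hu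
      exact ⟨φ₁ u, ⟨hu2, (hSiff u hu1).1 huS⟩, φ₁.left_inv hu1⟩
    · rintro ⟨y, ⟨hyW, hyY⟩, rfl⟩
      have hy1 := hWV hyW
      refine ⟨(hφs _).2 ⟨φ₁.map_target hy1, by rwa [φ₁.right_inv hy1]⟩, ?_⟩
      refine (hSiff _ (φ₁.map_target hy1)).2 ?_
      rw [φ₁.right_inv hy1]
      exact hyY
  rw [himg]
  exact hWc.image _ (φ₁.continuousOn_symm.mono fun y hy => hWV hy.1)

end NormalForm

end CrClass

/-! ### Components of the preimage and the assertions of the theorem -/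

namespace CrClass

section Components

variable {c : CrClass}
  {E : Type u} [AddCommGroup E] [Module c.field E] [TopologicalSpace E] [IsTopologicalAddGroup E]
  [ContinuousSMul c.field E] [PolynormableSpace c.field E] [T2Space E]
  {M : Type w} [TopologicalSpace M] [ChartedSpace E M]

/-- A connected set which is locally a submanifold is a submanifold: its model subspaces at
different points are related by automorphisms of the ambient space. -/
theorem exists_isSubmanifold_of_isPreconnected {C : Set M} (hC : IsPreconnected C)
    (h : ∀ x ∈ C, ∃ (Z : Submodule c.field E) (φ : OpenPartialHomeomorph M E),
      IsClosed (Z : Set E) ∧ c.IsSubmanifoldChart Z C φ ∧ x ∈ φ.source) {x : M} (hx : x ∈ C) :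
    ∃ Z : Submodule c.field E, c.IsSubmanifold Z C := by
  -- `choose!` needs a default chart for points outside `C`.
  have : Nonempty (OpenPartialHomeomorph M E) := ⟨chartAt E x⟩
  choose! Z φ hZ hφ hxφ using h
  have key : ∀ y ∈ C, ∀ y' ∈ C, ∃ A : E ≃L[c.field] E, ∀ v, v ∈ Z y ↔ A v ∈ Z y' := by
    intro y hy y' hy'
    -- The relation is transitive and symmetric, and the derivative of a chart transition gives it
    -- between nearby points; connectedness spreads it over `C`.
    refine hC.induction₂ (fun y y' => ∃ A : E ≃L[c.field] E, ∀ v, v ∈ Z y ↔ A v ∈ Z y') ?_ ?_ ?_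
      hy hy'
    · intro y hy
      filter_upwards [nhdsWithin_le_nhds ((φ y).open_source.mem_nhds (hxφ y hy)),
        self_mem_nhdsWithin] with y' hy1 hy'
      obtain ⟨A, -, hA⟩ := (hφ y hy).exists_deriv_transition (hφ y' hy') (hZ y hy) (hZ y' hy') hy'
        hy1 (hxφ y' hy')
      exact ⟨A, hA⟩
    · rintro y₁ y₂ y₃ - - - ⟨A, hA⟩ ⟨B, hB⟩
      exact ⟨A.trans B, fun v => (hA v).trans (hB (A v))⟩
    · rintro y₁ y₂ - - ⟨A, hA⟩
      exact ⟨A.symm, fun v => by rw [hA, A.apply_symm_apply]⟩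
  refine ⟨Z x, hZ x hx, fun y hy => ?_⟩
  obtain ⟨A, hA⟩ := key y hy x hx
  exact ⟨_, (hφ y hy).trans_equiv A hA, by simpa using hxφ y hy⟩

end Components

section Algebra

variable {c : CrClass}
  {E : Type u} [AddCommGroup E] [Module c.field E] [TopologicalSpace E] [IsTopologicalAddGroup E]
  [ContinuousSMul c.field E]
  {F : Type v} [AddCommGroup F] [Module c.field F] [TopologicalSpace F] [IsTopologicalAddGroup F]
  [ContinuousSMul c.field F]
  {Z : Submodule c.field E} {Y : Submodule c.field F}

/-- Codimension is preserved under preimages by surjective linear maps. -/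
theorem HasCodim.of_surjective {k : ℕ} (h : c.HasCodim Y k) (p : E →ₗ[c.field] F)
    (hp : Function.Surjective p) (hZ : ∀ v, v ∈ Z ↔ p v ∈ Y) : c.HasCodim Z k := by
  have hZ' : Z = LinearMap.ker (Y.mkQ.comp p) := by
    ext v
    rw [hZ, LinearMap.mem_ker, LinearMap.comp_apply, Submodule.mkQ_apply,
      Submodule.Quotient.mk_eq_zero]
  subst hZ'
  -- `Z` is the kernel of the surjection `E → F → F ⧸ Y`, so `E ⧸ Z ≃ F ⧸ Y`.
  let e := (Y.mkQ.comp p).quotKerEquivOfSurjective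
    ((Submodule.mkQ_surjective Y).comp hp)
  have := h.1
  exact ⟨Module.Finite.equiv e.symm, by rw [e.finrank_eq, h.2]⟩

/-- Complementability is preserved under preimages by split surjections. -/
theorem closedComplemented_of_split (h : Y.ClosedComplemented) (p : E →L[c.field] F)
    (σ : F →L[c.field] E) (hp : ∀ y, p (σ y) = y) (hZ : ∀ v, v ∈ Z ↔ p v ∈ Y) :
    Z.ClosedComplemented := by
  obtain ⟨q, hq⟩ := h
  -- Subtracting the `σ`-lift of the part of `p v` complementary to `Y` gives `p (r v) = q (p v) ∈
  -- Y`, and changes nothing when `p v ∈ Y`.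
  let r : E →L[c.field] E :=
    ContinuousLinearMap.id c.field E - σ.comp (p - (Y.subtypeL.comp q).comp p)
  have hr : ∀ v, r v = v - σ (p v - q (p v)) := fun v => rfl
  refine ⟨r.codRestrict Z fun v => ?_, fun v => ?_⟩
  · rw [hZ, hr, map_sub, hp, sub_sub_cancel]
    exact (q (p v)).2
  · apply Subtype.ext
    have h1 : q (p v) = ⟨p v, (hZ v).1 v.2⟩ := hq ⟨p v, (hZ v).1 v.2⟩
    rw [ContinuousLinearMap.coe_codRestrict_apply, hr, h1, sub_self, map_zero, sub_zero]

end Algebra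

section Preimage

variable {c : CrClass}
  {E : Type u} [AddCommGroup E] [Module c.field E] [TopologicalSpace E] [IsTopologicalAddGroup E]
  [ContinuousSMul c.field E] [PolynormableSpace c.field E] [T2Space E]
  {F : Type v} [AddCommGroup F] [Module c.field F] [TopologicalSpace F] [IsTopologicalAddGroup F]
  [ContinuousSMul c.field F] [PolynormableSpace c.field F] [T2Space F]
  {M : Type w} [TopologicalSpace M] [ChartedSpace E M] [c.IsCrManifold E M]
  {N : Type z} [TopologicalSpace N] [ChartedSpace F N] [c.IsCrManifold F N]
  {Y : Submodule c.field F} {S : Set N} {f : M → N}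

/-- The normal form of a submersion at a point of a connected component of the preimage of a
submanifold. -/
theorem IsSubmersion.exists_componentChart (hf : c.IsSubmersion E F f) (hS : c.IsSubmanifold Y S)
    {x y : M} (hy : y ∈ connectedComponentIn (f ⁻¹' S) x) :
    ∃ (φ : OpenPartialHomeomorph M E) (θ : OpenPartialHomeomorph N F) (π : E →L[c.field] F)
      (σ : F →L[c.field] E),
      c.IsSubmanifoldChart (Y.comap (π : E →ₗ[c.field] F)) (connectedComponentIn (f ⁻¹' S) x) φ ∧
      IsClosed (Y.comap (π : E →ₗ[c.field] F) : Set E) ∧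
      c.IsSubmanifoldChart Y S θ ∧ y ∈ φ.source ∧ MapsTo f φ.source θ.source ∧
      (∀ y, π (σ y) = y) ∧ (∀ u ∈ φ.source, θ (f u) = π (φ u)) ∧
      φ.source ∩ f ⁻¹' S ⊆ connectedComponentIn (f ⁻¹' S) x := by
  have hyS : f y ∈ S := connectedComponentIn_subset (f ⁻¹' S) x hy
  obtain ⟨φ, θ, π, σ, hφ, hθ, hyφ, hmaps, hπσ, hπ, hconn⟩ := hf.exists_normalForm hS hyS
  -- The piece is connected and contains `y`. Hence within `φ.source` the component and the whole
  -- preimage coincide, and one chart is adapted to both.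
  have hsub : φ.source ∩ f ⁻¹' S ⊆ connectedComponentIn (f ⁻¹' S) x := by
    rw [connectedComponentIn_eq hy]
    exact hconn.subset_connectedComponentIn ⟨hyφ, hyS⟩ inter_subset_right
  refine ⟨φ, θ, π, σ, isSubmanifoldChart_of_mem_iff hφ fun u hu => ?_,
    hS.isClosed.preimage π.continuous, hθ, hyφ, hmaps, hπσ, hπ, hsub⟩
  have h1 : φ u ∈ Y.comap (π : E →ₗ[c.field] F) ↔ f u ∈ S := by
    rw [hθ.mem_iff (hmaps hu), hπ u hu]
    rfl
  rw [h1]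
  exact ⟨fun h => connectedComponentIn_subset (f ⁻¹' S) x h, fun h => hsub ⟨hu, h⟩⟩

theorem IsSubmersion.isNotNecessarilyPureSubmanifold_preimage (hf : c.IsSubmersion E F f)
    (hS : c.IsSubmanifold Y S) : c.IsNotNecessarilyPureSubmanifold E (f ⁻¹' S) := by
  intro x hx
  constructor
  · rw [isOpen_iff_mem_nhds]
    intro y hy
    obtain ⟨φ, -, -, -, -, -, -, hyφ, -, -, -, hsub⟩ := hf.exists_componentChart hS hy
    filter_upwards [(φ.open_source.preimage continuous_subtype_val).mem_nhds hyφ] with z hz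
    exact hsub ⟨hz, z.2⟩
  · refine exists_isSubmanifold_of_isPreconnected isPreconnected_connectedComponentIn
      (fun y hy => ?_) (mem_connectedComponentIn hx)
    obtain ⟨φ, -, π, -, hφ, hcl, -, hyφ, -⟩ := hf.exists_componentChart hS hy
    exact ⟨_, φ, hcl, hφ, hyφ⟩

/-- The restriction of a map to submanifolds of source and target. -/
theorem IsMap.restrict_submanifold (hf : c.IsMap E F f) {Z : Submodule c.field E} {C : Set M}
    (hZ : c.IsSubmanifold Z C) (hS : c.IsSubmanifold Y S) (hCS : MapsTo f C S) :
    letI := hZ.chartedSpace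
    letI := hS.chartedSpace
    c.IsMap Z Y (MapsTo.restrict f C S hCS) := by
  have hcont : Continuous (MapsTo.restrict f C S hCS) := hf.1.restrict hCS
  refine ⟨hcont, ?_⟩
  rintro e ⟨φ, hφ, he⟩ d ⟨ψ, hψ, hd⟩
  have hO : IsOpen (e.target ∩ e.symm ⁻¹' (MapsTo.restrict f C S hCS ⁻¹' d.source)) :=
    e.isOpen_inter_preimage_symm (d.open_source.preimage hcont)
  have hO' : IsOpen (φ.target ∩ φ.symm ⁻¹' (f ⁻¹' ψ.source)) :=
    φ.isOpen_inter_preimage_symm (ψ.open_source.preimage hf.1)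
  refine On.of_comp_isClosedEmbedding Y.subtypeL hS.isClosed.isClosedEmbedding_subtypeVal hO ?_
  refine ((hf.on_charts hφ.isChart hψ.isChart).comp (On.clm Z.subtypeL hO) hO hO'
    fun y hy => ?_).congr hO fun y hy => ?_
  · have h1 := hy.2
    simp only [mem_preimage] at h1
    rw [hd.source_eq] at h1
    have h2 := hy.1
    rw [he.target_eq] at h2
    refine ⟨h2, ?_⟩
    show f (φ.symm (y : E)) ∈ ψ.source
    rw [← he.symm_apply_eq hy.1]
    exact h1
  · show ψ (f (φ.symm (y : E))) = _
    rw [← he.symm_apply_eq hy.1]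
    exact (hd.apply_eq _ hy.2).symm

/-- As `Z` is arbitrary, the normal-form chart is followed by an automorphism `A` carrying `π ⁻¹
(Y)` onto `Z`. In the restricted charts `f` is `π ∘ A⁻¹ : Z → Y`, with right inverse `A ∘ σ`. -/
theorem IsSubmersion.restrict_preimage (hf : c.IsSubmersion E F f) (hS : c.IsSubmanifold Y S)
    (x : M) {Z : Submodule c.field E}
    (hZ : c.IsSubmanifold Z (connectedComponentIn (f ⁻¹' S) x)) :
    letI := hZ.chartedSpace
    letI := hS.chartedSpace
    c.IsSubmersion Z Y (MapsTo.restrict f (connectedComponentIn (f ⁻¹' S) x) S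
      (connectedComponentIn_subset (f ⁻¹' S) x)) := by
  refine ⟨hf.1.restrict_submanifold hZ hS _, fun s => ?_⟩
  obtain ⟨φ, θ, π, σ, hφ, hcl, hθ, hyφ, hmaps, hπσ, hπ, -⟩ := hf.exists_componentChart hS s.2
  obtain ⟨ψ, hψ, hsψ⟩ := hZ.exists_chart s s.2
  obtain ⟨A, -, hA⟩ := hφ.exists_deriv_transition hψ hcl hZ.isClosed s.2 hyφ hsψ
  have hφA := hφ.trans_equiv A hA
  obtain ⟨e, he⟩ := hφA.exists_isRestriction s
  obtain ⟨d, hd⟩ := hθ.exists_isRestriction ⟨f s, connectedComponentIn_subset (f ⁻¹' S) x s.2⟩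
  have hπA : ∀ v : Z, π (A.symm v) ∈ Y := fun v => by
    have h1 : A.symm v ∈ Y.comap (π : E →ₗ[c.field] F) := by
      rw [hA, A.apply_symm_apply]
      exact v.2
    exact h1
  have hAσ : ∀ y : Y, A (σ y) ∈ Z := fun y => by
    rw [← hA]
    show π (σ y) ∈ Y
    rw [hπσ]
    exact y.2
  have hsource : ∀ u, u ∈ e.source → (u : M) ∈ φ.source := fun u hu => by
    rw [he.source_eq] at hu
    simpa using hu
  refine ⟨e, d, ((π.comp (A.symm : E →L[c.field] E)).comp Z.subtypeL).codRestrict Y hπA,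
    (((A : E →L[c.field] E).comp σ).comp Y.subtypeL).codRestrict Z hAσ,
    hZ.isChart_restriction hφA he, hS.isChart_restriction hθ hd, ?_, ?_, ?_, ?_, ?_⟩
  · rw [he.source_eq]
    simpa using hyφ
  · rw [hd.source_eq]
    exact hmaps hyφ
  · intro u hu
    rw [hd.source_eq]
    exact hmaps (hsource u hu)
  · intro y
    apply Subtype.ext
    show π (A.symm (A (σ y))) = y
    rw [A.symm_apply_apply, hπσ]
  · intro y hy
    apply Subtype.ext
    have h1 := e.map_target hy
    have h2 := hsource _ h1
    have h3 : MapsTo.restrict f (connectedComponentIn (f ⁻¹' S) x) S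
        (connectedComponentIn_subset (f ⁻¹' S) x) (e.symm y) ∈ d.source := by
      rw [hd.source_eq]
      exact hmaps h2
    rw [hd.apply_eq _ h3]
    show θ (f (e.symm y : M)) = π (A.symm y)
    rw [hπ _ h2]
    have h4 : A (φ (e.symm y : M)) = y := by
      have := he.apply_eq _ h1
      rw [e.right_inv hy] at this
      exact this.symm
    rw [← h4, A.symm_apply_apply]

/-- In normal-form charts the tangent map is `π` and the two tangent spaces are `π ⁻¹ (Y)` and `Y`.
The chain rule `B ∘ L = π ∘ D` transports this to the preferred charts. -/
theorem IsSubmersion.tangent_preimage (hf : c.IsSubmersion E F f) (hS : c.IsSubmanifold Y S)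
    {x : M} (hx : x ∈ f ⁻¹' S) {Z : Submodule c.field E}
    (hZ : c.IsSubmanifold Z (connectedComponentIn (f ⁻¹' S) x)) :
    hZ.tangent ⟨x, mem_connectedComponentIn hx⟩ =
      c.tangentMap E F f x ⁻¹' hS.tangent ⟨f x, hx⟩ := by
  obtain ⟨φ, θ, π, σ, hφ, hcl, hθ, hxφ, hmaps, hπσ, hπ, -⟩ :=
    hf.exists_componentChart hS (mem_connectedComponentIn hx)
  set κ := chartAt E x with hκ
  set μ := chartAt F (f x) with hμ
  have hκc : c.IsChart κ := isChart_chartAt x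
  have hμc : c.IsChart μ := isChart_chartAt (f x)
  have hxκ : x ∈ κ.source := mem_chart_source E x
  have hxμ : f x ∈ μ.source := mem_chart_source F (f x)
  obtain ⟨D, hD, -⟩ := hκc.exists_deriv_transition hφ.isChart hxκ hxφ
  obtain ⟨B, hB, -⟩ := hμc.exists_deriv_transition hθ.isChart hxμ (hmaps hxφ)
  have hO : κ x ∈ κ.target ∩ κ.symm ⁻¹' (f ⁻¹' μ.source) :=
    ⟨κ.map_source hxκ, by simpa only [mem_preimage, κ.left_inv hxκ] using hxμ⟩
  have hOo : IsOpen (κ.target ∩ κ.symm ⁻¹' (f ⁻¹' μ.source)) :=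
    κ.isOpen_inter_preimage_symm (μ.open_source.preimage hf.1.1)
  obtain ⟨L, hL⟩ := (hf.1.on_charts hκc hμc).exists_hadamardDeriv hOo hO
  have hBL : (B : F →L[c.field] F).comp L = π.comp (D : E →L[c.field] E) := by
    have hB' : HasHadamardDeriv c (fun y => θ (μ.symm y)) (B : F →L[c.field] F)
        (μ (f (κ.symm (κ x)))) := by rwa [κ.left_inv hxκ]
    refine (HasHadamardDeriv.comp (f := fun y => μ (f (κ.symm y))) hB' hL).eq_of_eventuallyEq
      ((HasHadamardDeriv.clm π _).comp hD) ?_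
    have h1 : κ.target ∩ κ.symm ⁻¹' φ.source ∈ 𝓝 (κ x) :=
      (κ.isOpen_inter_preimage_symm φ.open_source).mem_nhds
        ⟨κ.map_source hxκ, by simpa only [mem_preimage, κ.left_inv hxκ] using hxφ⟩
    filter_upwards [hOo.mem_nhds hO, h1] with y hy hy'
    rw [μ.left_inv hy.2, hπ _ hy'.2]
  ext w
  have h1 := hZ.mem_tangent_iff (c := c) ⟨x, mem_connectedComponentIn hx⟩ hφ hcl hxφ hD w
  have h2 := hS.mem_tangent_iff (c := c) ⟨f x, hx⟩ hθ hS.isClosed (hmaps hxφ) hB (L w)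
  rw [mem_preimage, tangentMap_eq_of_hasHadamardDeriv hL w, h1, h2]
  have h3 : B (L w) = π (D w) := congrArg (fun T : E →L[c.field] F => T w) hBL
  show π (D w) ∈ Y ↔ B (L w) ∈ Y
  rw [h3]

/-- The model subspace of a component of the preimage is the preimage of the model subspace under
a split surjection. -/
theorem IsSubmersion.exists_split_model (hf : c.IsSubmersion E F f) (hS : c.IsSubmanifold Y S)
    {x : M} (hx : x ∈ f ⁻¹' S) {Z : Submodule c.field E}
    (hZ : c.IsSubmanifold Z (connectedComponentIn (f ⁻¹' S) x)) :
    ∃ (p : E →L[c.field] F) (σ : F →L[c.field] E), (∀ y, p (σ y) = y) ∧ ∀ v, v ∈ Z ↔ p v ∈ Y := by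
  have hxC := mem_connectedComponentIn hx
  obtain ⟨φ, θ, π, σ, hφ, hcl, -, hxφ, -, hπσ, -⟩ := hf.exists_componentChart hS hxC
  obtain ⟨ψ, hψ, hsψ⟩ := hZ.exists_chart x hxC
  obtain ⟨A, -, hA⟩ := hψ.exists_deriv_transition hφ hZ.isClosed hcl hxC hsψ hxφ
  refine ⟨π.comp (A : E →L[c.field] E), (A.symm : E →L[c.field] E).comp σ, fun y => ?_, hA⟩
  show π (A (A.symm (σ y))) = y
  rw [A.apply_symm_apply, hπσ]

end Preimage

end CrClass

theorem theoremC (c : CrClass)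
    {E : Type*} [AddCommGroup E] [Module c.field E] [TopologicalSpace E] [IsTopologicalAddGroup E]
    [ContinuousSMul c.field E] [PolynormableSpace c.field E] [T2Space E]
    {F : Type*} [AddCommGroup F] [Module c.field F] [TopologicalSpace F] [IsTopologicalAddGroup F]
    [ContinuousSMul c.field F] [PolynormableSpace c.field F] [T2Space F]
    {M : Type*} [TopologicalSpace M] [T2Space M] [ChartedSpace E M] [c.IsCrManifold E M]
    {N : Type*} [TopologicalSpace N] [T2Space N] [ChartedSpace F N] [c.IsCrManifold F N]
    (f : M → N) (hf : c.IsSubmersion E F f)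
    (Y : Submodule c.field F) (S : Set N) (hS : c.IsSubmanifold Y S) :
    c.IsNotNecessarilyPureSubmanifold E (f ⁻¹' S) ∧
    ∀ (x : M) (hx : x ∈ f ⁻¹' S) (Z : Submodule c.field E)
      (hZ : c.IsSubmanifold Z (connectedComponentIn (f ⁻¹' S) x)),
      (letI := hZ.chartedSpace
       letI := hS.chartedSpace
       c.IsSubmersion Z Y
        (MapsTo.restrict f (connectedComponentIn (f ⁻¹' S) x) S
          (connectedComponentIn_subset (f ⁻¹' S) x))) ∧
      hZ.tangent ⟨x, mem_connectedComponentIn hx⟩ =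
        c.tangentMap E F f x ⁻¹' hS.tangent ⟨f x, hx⟩ ∧
      (∀ k : ℕ, c.HasCodim Y k → c.HasCodim Z k) ∧
      (Y.ClosedComplemented → Z.ClosedComplemented) := by
  refine ⟨hf.isNotNecessarilyPureSubmanifold_preimage hS, fun x hx Z hZ =>
    ⟨hf.restrict_preimage hS x hZ, hf.tangent_preimage hS hx hZ, fun k hk => ?_, fun hY => ?_⟩⟩
  · obtain ⟨p, σ, hp, hZY⟩ := hf.exists_split_model hS hx hZ
    exact hk.of_surjective (p : E →ₗ[c.field] F) (fun y => ⟨σ y, hp y⟩) hZY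
  · obtain ⟨p, σ, hp, hZY⟩ := hf.exists_split_model hS hx hZ
    exact CrClass.closedComplemented_of_split hY p σ hp hZY
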